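/- **Setting.** Let $n,k,p_1,p_2$ be nonnegative integers with $2\le k\le n$ and $n>p_1+p_2+1$, and put $p=p_1+p_2$. For an $n\times n$ permutation matrix $\Pi$ let $d(\Pi,I_n)=\#\{i:\Pi_{ii}=0\}$, and let $\mathcal P_{n,k}$ be the set of permutation matrices with $d(\Pi,I_n)\le k$. Let $X\in\mathbb R^{n\times p_1}$, $Z\in\mathbb R^{n\times p_2}$, $\beta_1\in\mathbb R^{p_1}$, $\beta_2\in\mathbb R^{p_2}$, $\sigma_0>0$ and $\Pi_0\in\mathcal P_{n,k}$ be fixed, and consider $$Y=\Pi_0X\beta_1+Z\beta_2+\sigma_0U,\qquad U\sim N(0,I_n).$$ For a matrix $A$ with $n$ rows, $M_A$ is the orthogonal projection onto the range of $A$. Write $W(\Pi)=[\Pi X,\,Z]$ and $$C:=C_{\min}^{\mathrm{partial}}(\Pi_0):=\min_{\Pi\in\mathcal P_{n,k},\ \Pi\ne\Pi_0}\frac{\bigl\|(I_n-M_{W(\Pi)})(\Pi_0X\beta_1+Z\beta_2)\bigr\|_2^2}{n\max\{d(\Pi_0,I_n)-d(\Pi,I_n),\,1\}}.$$ Let $U_1^*,\dots,U_L^*\sim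 N(0,I_n)$ be such that $U,U_1^*,\dots,U_L^*$ are independent. For each $\ell$ let $\hat\Pi_\ell$ be any minimizer over $\Pi\in\mathcal P_{n,k}$ of $\|(I_n-M_{(W(\Pi),U_\ell^*)})Y\|_2^2$, ties being broken in an arbitrary way, and let $\mathcal C^{(L)}=\{\hat\Pi_1,\dots,\hat\Pi_L\}$. Put $\Psi(x)=x-1-\log x$, let $D_m$ be the number of derangements of $m$ elements, and for $\gamma\in(0,1/4]$ define $$\begin{aligned}\Delta_{\mathrm{partial}}(\gamma)=&\sum_{m=n-k}^n\binom nm D_{n-m}\Bigl\{e^{-\frac n2\Psi\left(\max\left\{1,\frac{C\log(e/\gamma)}{2\sigma_0^2\gamma}\right\}\right)}+e^{-\frac n2\Psi\left(\max\left\{1,\frac{C\log^2(e/\gamma)}{16\sigma_0^2}\right\}\right)}\Bigr\}\\&+\Bigl(\frac\pi2\Bigr)^{n-p-2}|\mathcal P_{n,k}|\Bigl(\gamma\log\frac e\gamma\Bigr)^{\frac{n-p-1}2},\end{aligned}$$ $$\gamma_L=\min\Bigl\{\frac14,\Bigl(\frac{(n-1)\log(eL)}{L}\Bigr)^{1/(n-1)}\Bigr\},\qquad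 \delta_L=\Delta_{\mathrm{partial}}(\gamma_L)+\Bigl(1-\frac{\gamma_L^{n-1}}{n-1}\Bigr)^L.$$ **Theorem.** Suppose $C_{\min}^{\mathrm{partial}}(\Pi_0)>0$. Then for every $\gamma\in(0,1/4]$ and every integer $L\ge2$, $$\mathbb P\bigl(\Pi_0\notin\mathcal C^{(L)}\bigr)\le\Delta_{\mathrm{partial}}(\gamma)+\Bigl(1-\frac{\gamma^{n-1}}{n-1}\Bigr)^L .$$ In particular $\mathbb P(\Pi_0\notin\mathcal C^{(L)})\le\delta_L$ for every $L\ge2$, and, with $n,k,X,Z,\Pi_0,\beta_1,\beta_2,\sigma_0$ fixed, $$\delta_L=O\!\left(\frac{(\log L)^{(n-p_1-p_2)/2}}{L^{(n-p_1-p_2-1)/(2(n-1))}}\right)\qquad(L\to\infty).$$ -/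

import Mathlib

open MeasureTheory ProbabilityTheory Filter Asymptotics

noncomputable section

namespace PartialShuffle

/-- The Hamming distance `d(τ, I) = #{i : (permutation matrix of τ) i i = 0}`. -/
def hammingToId {n : ℕ} (τ : Equiv.Perm (Fin n)) : ℕ :=
  (Finset.univ.filter fun i => τ.permMatrix ℝ i i = 0).card

/-- The `k`-sparse permutations, those with `d(τ, I) ≤ k`. -/
def sparsePerms (n k : ℕ) : Finset (Equiv.Perm (Fin n)) :=
  Finset.univ.filter fun τ => hammingToId τ ≤ k

/-- The range (column space) of a matrix with `n` rows. -/
def colSpace {n : ℕ} {ι : Type*} [Fintype ι] [DecidableEq ι] (A : Matrix (Fin n) ι ℝ) :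
    Submodule ℝ (EuclideanSpace ℝ (Fin n)) :=
  LinearMap.range (Matrix.toEuclideanLin A)

/-- The residual `(I - M_A) v`, where `M_A` is the orthogonal projection onto the range of `A`. -/
def projResidual {n : ℕ} {ι : Type*} [Fintype ι] [DecidableEq ι] (A : Matrix (Fin n) ι ℝ)
    (v : EuclideanSpace ℝ (Fin n)) : EuclideanSpace ℝ (Fin n) :=
  v - (colSpace A).starProjection v

variable {n p₁ p₂ : ℕ}

/-- The expanded design `W(τ) = [τ X, Z]`, with the permutation matrix of `τ` acting on `X`. -/
def design (X : Matrix (Fin n) (Fin p₁) ℝ) (Z : Matrix (Fin n) (Fin p₂) ℝ)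
    (τ : Equiv.Perm (Fin n)) : Matrix (Fin n) (Fin p₁ ⊕ Fin p₂) ℝ :=
  Matrix.fromCols (τ.permMatrix ℝ * X) Z

/-- The matrix `(W(τ), u)`: the expanded design augmented with the column `u`. -/
def augDesign (X : Matrix (Fin n) (Fin p₁) ℝ) (Z : Matrix (Fin n) (Fin p₂) ℝ)
    (τ : Equiv.Perm (Fin n)) (u : EuclideanSpace ℝ (Fin n)) :
    Matrix (Fin n) ((Fin p₁ ⊕ Fin p₂) ⊕ Unit) ℝ :=
  Matrix.fromCols (design X Z τ) (Matrix.replicateCol Unit u.ofLp)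

/-- The noiseless response `W(τ) (β₁, β₂) = τ X β₁ + Z β₂`. -/
def signal (X : Matrix (Fin n) (Fin p₁) ℝ) (Z : Matrix (Fin n) (Fin p₂) ℝ)
    (τ : Equiv.Perm (Fin n)) (β₁ : Fin p₁ → ℝ) (β₂ : Fin p₂ → ℝ) : EuclideanSpace ℝ (Fin n) :=
  WithLp.toLp 2 (Matrix.mulVec (τ.permMatrix ℝ * X) β₁ + Matrix.mulVec Z β₂)

/-- The observed response `Y = τ X β₁ + Z β₂ + σ u`. -/
def response (X : Matrix (Fin n) (Fin p₁) ℝ) (Z : Matrix (Fin n) (Fin p₂) ℝ)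
    (τ : Equiv.Perm (Fin n)) (β₁ : Fin p₁ → ℝ) (β₂ : Fin p₂ → ℝ) (σ : ℝ)
    (u : EuclideanSpace ℝ (Fin n)) : EuclideanSpace ℝ (Fin n) :=
  signal X Z τ β₁ β₂ + σ • u

/-- The objective `‖(I - M_{(W(τ), u)}) y‖²` for the artificial noise `u`. -/
def reproObjective (X : Matrix (Fin n) (Fin p₁) ℝ) (Z : Matrix (Fin n) (Fin p₂) ℝ)
    (y u : EuclideanSpace ℝ (Fin n)) (τ : Equiv.Perm (Fin n)) : ℝ :=
  ‖projResidual (augDesign X Z τ u) y‖ ^ 2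

/-- The set of all minimizers of the objective over the `k`-sparse permutations. -/
def reproArgmin (k : ℕ) (X : Matrix (Fin n) (Fin p₁) ℝ) (Z : Matrix (Fin n) (Fin p₂) ℝ)
    (y u : EuclideanSpace ℝ (Fin n)) : Set (Equiv.Perm (Fin n)) :=
  {τ | τ ∈ sparsePerms n k ∧ IsMinOn (reproObjective X Z y u) (sparsePerms n k) τ}

/-- The candidate set formed by the selected minimizers `τhat 1, …, τhat L`. -/
def candidateSet (k : ℕ) {L : ℕ} (τhat : Fin L → Equiv.Perm (Fin n)) :
    Set (Equiv.Perm (Fin n)) :=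
  {τ | τ ∈ sparsePerms n k ∧ ∃ l, τhat l = τ}

/-- The separation constant `C_min^partial(τ₀)`. It is an infimum over finitely many competitors
`τ ≠ τ₀`, hence a minimum as soon as there is one (that is, if `2 ≤ k` and `2 ≤ n`); for an empty
set of competitors the value is `0`. -/
def cMinPartial (k : ℕ) (X : Matrix (Fin n) (Fin p₁) ℝ) (Z : Matrix (Fin n) (Fin p₂) ℝ)
    (τ₀ : Equiv.Perm (Fin n)) (β₁ : Fin p₁ → ℝ) (β₂ : Fin p₂ → ℝ) : ℝ :=
  ⨅ τ : {τ : Equiv.Perm (Fin n) // τ ∈ sparsePerms n k ∧ τ ≠ τ₀},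
    ‖projResidual (design X Z τ.1) (signal X Z τ₀ β₁ β₂)‖ ^ 2 /
      ((n : ℝ) * max ((hammingToId τ₀ : ℝ) - (hammingToId τ.1 : ℝ)) 1)

/-- `Ψ(x) = x - 1 - log x`. -/
def Psi (x : ℝ) : ℝ := x - 1 - Real.log x

/-- The bound `Δ(γ)` with separation constant `C`, total dimension `p` and noise level `σ`. -/
def Delta (n k p : ℕ) (C σ γ : ℝ) : ℝ :=
  (∑ m ∈ Finset.Icc (n - k) n, (n.choose m : ℝ) * (numDerangements (n - m) : ℝ)) *
      (Real.exp (-((n : ℝ) / 2) *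
          Psi (max 1 (C * Real.log (Real.exp 1 / γ) / (2 * σ ^ 2 * γ)))) +
        Real.exp (-((n : ℝ) / 2) *
          Psi (max 1 (C * Real.log (Real.exp 1 / γ) ^ 2 / (16 * σ ^ 2))))) +
    (Real.pi / 2) ^ ((n : ℝ) - (p : ℝ) - 2) * ((sparsePerms n k).card : ℝ) *
      (γ * Real.log (Real.exp 1 / γ)) ^ (((n : ℝ) - (p : ℝ) - 1) / 2)

/-- The finite-sample bound `Δ(γ) + (1 - γ^(n-1)/(n-1))^L`. -/
def missBound (n k p : ℕ) (C σ γ : ℝ) (L : ℕ) : ℝ :=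
  Delta n k p C σ γ + (1 - γ ^ (n - 1) / ((n : ℝ) - 1)) ^ L

/-- `γ_L = min {1/4, ((n-1) log(e L) / L)^(1/(n-1))}`. -/
def gammaSeq (n L : ℕ) : ℝ :=
  min (1 / 4) ((((n : ℝ) - 1) * Real.log (Real.exp 1 * (L : ℝ)) / (L : ℝ)) ^ (1 / ((n : ℝ) - 1)))

/-- The joint law of `(U*_1, …, U*_L, U)`: independent standard Gaussian vectors in `ℝⁿ`. -/
def noiseLaw (n L : ℕ) :
    Measure ((Fin L → EuclideanSpace ℝ (Fin n)) × EuclideanSpace ℝ (Fin n)) :=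
  (Measure.pi fun _ => stdGaussian (EuclideanSpace ℝ (Fin n))).prod
    (stdGaussian (EuclideanSpace ℝ (Fin n)))

end PartialShuffle

end

namespace PartialShuffle

/-! If some artificial draw `v = U*_l` is nearly parallel to `U`, then `(W(τ₀), v)` almost
reproduces `Y`: its residual is at most `σ₀ ‖U - c v‖` for a suitable `c`. A competitor `τ` can do
as well only if adding the column `v` to `W(τ)` absorbs most of `a_τ`, the part of the signal
orthogonal to `W(τ)`. That needs either `v` in a narrow cone around `a_τ` inside the orthogonal
complement of `W(τ)` (`badCone`), or a large `‖U‖`, since `‖a_τ‖² ≥ n C`. This deterministic step is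
`lt_of_mem_reproArgmin`.

So `τ₀` is missed only if `‖U‖²` is large (a chi-square tail), or every draw close to `U` lies in
the union `B` of the bad cones. By rotation invariance the probability `p` that a draw is close to
`U` does not depend on `U`; averaging over `U` then bounds the second event by `(1 - p) ^ L + G(B)`,
with no factor `L` on `G(B)` (`pi_prod_neighbourhood_le`).

It remains to measure Gaussian cones: `axisCone_upper` (a Chernoff bound) controls `G(B)`, and
`axisCone_lower` (integration over slices) gives `p ≥ γ^(n-1)/(n-1)`. The other factors and the
first exponential of `Delta` are slack. For the rate, `γ_L` makes the miss term at most `1/L` for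
large `L`, the exponentials decay like `exp(-c log² L)`, and the cone term dominates. -/

/-! ### Chernoff bounds for diagonal Gaussian quadratic forms -/

lemma exp_mul_sq_mul_gaussianPDFReal (w x : ℝ) :
    gaussianPDFReal 0 1 x * Real.exp (w * x ^ 2) =
      (√(2 * Real.pi))⁻¹ * Real.exp (-(1 / 2 - w) * x ^ 2) := by
  simp only [gaussianPDFReal, NNReal.coe_one, mul_one, sub_zero]
  rw [mul_assoc, ← Real.exp_add]
  congr 2
  ring

lemma integrable_exp_mul_sq_gaussianReal {w : ℝ} (hw : w < 1 / 2) :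
    Integrable (fun x => Real.exp (w * x ^ 2)) (gaussianReal 0 1) := by
  rw [gaussianReal_of_var_ne_zero _ one_ne_zero]
  rw [integrable_withDensity_iff_integrable_smul' (measurable_gaussianPDF _ _)
    (ae_of_all _ fun x => gaussianPDF_lt_top)]
  simp only [toReal_gaussianPDF, smul_eq_mul, exp_mul_sq_mul_gaussianPDFReal]
  exact (integrable_exp_neg_mul_sq (by linarith)).const_mul _

lemma integral_exp_mul_sq_gaussianReal {w : ℝ} (hw : w < 1 / 2) :
    ∫ x, Real.exp (w * x ^ 2) ∂(gaussianReal 0 1) = (√(1 - 2 * w))⁻¹ := by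
  rw [integral_gaussianReal_eq_integral_smul one_ne_zero]
  simp only [smul_eq_mul, exp_mul_sq_mul_gaussianPDFReal]
  rw [integral_const_mul, integral_gaussian, ← Real.sqrt_inv, ← Real.sqrt_inv,
    ← Real.sqrt_mul (by positivity)]
  congr 1
  have : 1 - 2 * w ≠ 0 := by linarith
  have : 1 / 2 - w ≠ 0 := by linarith
  field_simp

lemma gaussian_pi_chernoff {ι : Type*} [Fintype ι] {w : ι → ℝ} (hw : ∀ i, w i < 1 / 2) (c : ℝ) :
    (Measure.pi fun _ : ι => gaussianReal 0 1).real {x | c ≤ ∑ i, w i * x i ^ 2} ≤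
      Real.exp (-c) * ∏ i, (√(1 - 2 * w i))⁻¹ := by
  have hint : Integrable (fun x : ι → ℝ => Real.exp (1 * ∑ i, w i * x i ^ 2))
      (Measure.pi fun _ : ι => gaussianReal 0 1) := by
    simp only [one_mul, Real.exp_sum]
    exact Integrable.fintype_prod (f := fun i x => Real.exp (w i * x ^ 2))
      fun i => integrable_exp_mul_sq_gaussianReal (hw i)
  have h := measure_ge_le_exp_mul_mgf c zero_le_one hint
  refine h.trans_eq ?_
  simp only [mgf, one_mul, neg_mul, Real.exp_sum]
  rw [integral_fintype_prod_eq_prod (f := fun i x => Real.exp (w i * x ^ 2))]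
  simp_rw [integral_exp_mul_sq_gaussianReal (hw _)]

lemma norm_sq_sum_smul {E : Type*} [NormedAddCommGroup E] [InnerProductSpace ℝ E]
    {ι : Type*} [Fintype ι] (b : OrthonormalBasis ι ℝ E) (x : ι → ℝ) :
    ‖∑ i, x i • b i‖ ^ 2 = ∑ i, x i ^ 2 := by
  classical
  rw [← b.sum_sq_inner_right]
  simp [b.inner_eq_ite, inner_sum, inner_smul_right]

/-! ### Rotation invariance: chi-square tail and Gaussian mass of cones -/

section

variable {E : Type*} [NormedAddCommGroup E] [InnerProductSpace ℝ E] [FiniteDimensional ℝ E]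
  [MeasurableSpace E] [BorelSpace E]

lemma stdGaussian_measureReal_eq_pi {ι : Type*} [Fintype ι] (b : OrthonormalBasis ι ℝ E)
    {s : Set E} (hs : MeasurableSet s) :
    (stdGaussian E).real s =
      (Measure.pi fun _ : ι => gaussianReal 0 1).real {x | ∑ i, x i • b i ∈ s} := by
  rw [stdGaussian_eq_map_pi_orthonormalBasis b, map_measureReal_apply (by fun_prop) hs]
  rfl

/-- The chi-square upper tail. -/
lemma stdGaussian_norm_sq_ge_le {n : ℕ} (hn : Module.finrank ℝ E = n) (x : ℝ) :
    (stdGaussian E).real {v | n * x ≤ ‖v‖ ^ 2} ≤ Real.exp (-(n / 2) * Psi (max 1 x)) := by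
  rcases le_total x 1 with hx | hx
  · rw [max_eq_left hx]
    simp [Psi, measureReal_le_one]
  rw [max_eq_right hx]
  have hx0 : 0 < x := by linarith
  subst hn
  rw [stdGaussian_measureReal_eq_pi (stdOrthonormalBasis ℝ E)
    (measurableSet_le (by fun_prop) (by fun_prop))]
  simp only [Set.mem_ofPred_eq, norm_sq_sum_smul]
  have hinv : x⁻¹ ≤ 1 := inv_le_one_of_one_le₀ hx
  have hinv0 : 0 < x⁻¹ := by positivity
  -- The weight `(1 - 1/x)/2` minimizes the Chernoff exponent: it solves `1 - 2w = 1/x`.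
  have h := gaussian_pi_chernoff (ι := Fin (Module.finrank ℝ E))
    (w := fun _ => (1 - x⁻¹) / 2) (fun _ => by linarith)
    ((1 - x⁻¹) / 2 * (Module.finrank ℝ E * x))
  refine (measureReal_mono ?_).trans (h.trans_eq ?_)
  · intro v hv
    simp only [Set.mem_ofPred_eq] at hv ⊢
    rw [← Finset.mul_sum]
    exact mul_le_mul_of_nonneg_left hv (by linarith)
  · have e1 : 1 - 2 * ((1 - x⁻¹) / 2) = x⁻¹ := by ring
    simp only [e1, Finset.prod_const, Finset.card_univ, Fintype.card_fin]
    rw [← Real.sqrt_inv, inv_inv, Real.sqrt_eq_rpow, Real.rpow_def_of_pos hx0, ← Real.exp_nat_mul,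
      ← Real.exp_add, Psi]
    congr 1
    field_simp
    ring

/-- The cone of half-angle `arccos √c` around the first axis. -/
def axisCone (d : ℕ) (c : ℝ) : Set (Fin (d + 1) → ℝ) := {x | c * ∑ i, x i ^ 2 ≤ x 0 ^ 2}

/-- In an orthonormal basis whose first vector is `u / ‖u‖`, the coordinates are again independent
standard Gaussians and the cone is `axisCone`. The value is therefore the same for all `u ≠ 0`. -/
lemma stdGaussian_cone_eq {d : ℕ} (hd : Module.finrank ℝ E = d + 1) (c : ℝ) {u : E} (hu : u ≠ 0) :
    (stdGaussian E).real {v | c * (‖u‖ ^ 2 * ‖v‖ ^ 2) ≤ inner ℝ u v ^ 2} =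
      (Measure.pi fun _ => gaussianReal 0 1).real (axisCone d c) := by
  have hu' : 0 < ‖u‖ := norm_pos_iff.mpr hu
  obtain ⟨b, hb⟩ := Orthonormal.exists_orthonormalBasis_extension_of_card_eq (𝕜 := ℝ) (E := E)
    (ι := Fin (d + 1)) (by simpa using hd) (v := fun _ => ‖u‖⁻¹ • u) (s := {0}) (by
      rw [orthonormal_iff_ite]
      rintro ⟨i, rfl⟩ ⟨j, rfl⟩
      simp [norm_smul, hu'.ne'])
  have hb0 : u = ‖u‖ • b 0 := by
    rw [hb 0 rfl, smul_smul, mul_inv_cancel₀ hu'.ne', one_smul]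
  rw [stdGaussian_measureReal_eq_pi b (measurableSet_le (by fun_prop) (by fun_prop))]
  congr 1
  ext x
  have h1 : inner ℝ u (∑ i, x i • b i) = ‖u‖ * x 0 := by
    conv_lhs => rw [hb0]
    simp [inner_smul_left, inner_sum, inner_smul_right, b.inner_eq_ite, mul_comm]
  simp only [Set.mem_ofPred_eq, norm_sq_sum_smul, h1, axisCone]
  rw [mul_pow, mul_left_comm]
  exact mul_le_mul_iff_right₀ (by positivity)

lemma stdGaussian_map_orthogonalProjectionOnto (K : Submodule ℝ E) :
    (stdGaussian E).map K.orthogonalProjectionOnto = stdGaussian K := by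
  apply Measure.ext_of_charFun
  ext t
  have h : charFun ((stdGaussian E).map K.orthogonalProjectionOnto) t =
      charFun (stdGaussian E) (t : E) := by
    rw [charFun_apply, charFun_apply, integral_map (by fun_prop)
      (Measurable.aestronglyMeasurable (by fun_prop))]
    simp_rw [K.inner_orthogonalProjectionOnto_eq_of_mem_right]
  rw [h, charFun_stdGaussian, charFun_stdGaussian, Submodule.coe_norm]

/-- Since `a ∈ K`, the condition involves `v` only through its projection to `K`, which is standard
Gaussian on `K`; the dimension that counts is that of `K`. -/
lemma stdGaussian_subspace_cone_eq {d : ℕ} (K : Submodule ℝ E)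
    (hd : Module.finrank ℝ K = d + 1) (c : ℝ) {a : E} (ha : a ∈ K) (ha0 : a ≠ 0) :
    (stdGaussian E).real {v | c * (‖a‖ ^ 2 * ‖K.starProjection v‖ ^ 2) ≤ inner ℝ a v ^ 2} =
      (Measure.pi fun _ => gaussianReal 0 1).real (axisCone d c) := by
  rw [← stdGaussian_cone_eq hd c (u := ⟨a, ha⟩) (by simpa [Subtype.ext_iff] using ha0),
    ← stdGaussian_map_orthogonalProjectionOnto K, map_measureReal_apply (by fun_prop)
      (measurableSet_le (by fun_prop) (by fun_prop))]
  congr 1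
  ext v
  have : inner ℝ (⟨a, ha⟩ : K) (K.orthogonalProjectionOnto v) = inner ℝ a v :=
    K.inner_orthogonalProjectionOnto_eq_of_mem_left ⟨a, ha⟩ v
  simp only [Set.mem_ofPred_eq, Set.mem_preimage, this]
  rfl

end

/-! ### Upper and lower bounds for the mass of a narrow cone -/

lemma axisCone_upper {d : ℕ} {q : ℝ} (hq : 0 < q) (hq1 : q < 1) :
    (Measure.pi fun _ => gaussianReal 0 1).real (axisCone d (1 - q)) ≤
      √2 * √(2 * q / (1 + q)) ^ d := by
  -- The cone says that `x₀²/4 - (1 - q)/(4q) · ∑ xᵢ²`, summed over the other coordinates, is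
  -- nonnegative: Chernoff at level `0`.
  have h := gaussian_pi_chernoff (ι := Fin (d + 1))
    (w := fun i => if i = 0 then 1 / 4 else - ((1 - q) / (4 * q))) (by
      intro i
      split_ifs
      · norm_num
      · have : 0 ≤ (1 - q) / (4 * q) := div_nonneg (by linarith) (by linarith)
        linarith) 0
  refine (measureReal_mono ?_).trans (h.trans_eq ?_)
  · intro x hx
    simp only [axisCone, Set.mem_ofPred_eq, Fin.sum_univ_succ, Fin.succ_ne_zero, if_true,
      if_false] at hx ⊢
    rw [← Finset.mul_sum]
    have : (1 - q) / (4 * q) * ∑ i : Fin d, x i.succ ^ 2 ≤ 1 / 4 * x 0 ^ 2 := by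
      rw [div_mul_eq_mul_div, div_le_iff₀ (by linarith)]
      nlinarith
    linarith
  · rw [Fin.prod_univ_succ]
    have e : 1 - 2 * -((1 - q) / (4 * q)) = (2 * q / (1 + q))⁻¹ := by
      field_simp
      ring
    simp only [Fin.succ_ne_zero, if_true, if_false, e, Finset.prod_const, Finset.card_univ,
      Fintype.card_fin, neg_zero, Real.exp_zero, one_mul, Real.sqrt_inv, inv_inv]
    congr 1
    rw [← Real.sqrt_inv]
    norm_num

lemma gaussian_pi_eq_withDensity (d : ℕ) :
    (Measure.pi fun _ : Fin d => gaussianReal 0 1) =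
      (volume : Measure (Fin d → ℝ)).withDensity
        fun x => ENNReal.ofReal (∏ i, gaussianPDFReal 0 1 (x i)) := by
  refine Measure.pi_eq fun s hs => ?_
  have hpdf : ∀ i : Fin d, Integrable ((s i).indicator (gaussianPDFReal 0 1)) :=
    fun i => (integrable_gaussianPDFReal 0 1).indicator (hs i)
  have hnn : ∀ (i : Fin d) (x : ℝ), 0 ≤ (s i).indicator (gaussianPDFReal 0 1) x :=
    fun i x => Set.indicator_nonneg (fun y _ => gaussianPDFReal_nonneg 0 1 y) x
  have hind : ∀ x : Fin d → ℝ, (Set.univ.pi s).indicator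
      (fun x => ENNReal.ofReal (∏ i, gaussianPDFReal 0 1 (x i))) x =
      ENNReal.ofReal (∏ i, (s i).indicator (gaussianPDFReal 0 1) (x i)) := by
    intro x
    by_cases hx : x ∈ Set.univ.pi s
    · rw [Set.indicator_of_mem hx]
      congr 1
      exact Finset.prod_congr rfl fun i _ => (Set.indicator_of_mem (hx i trivial) _).symm
    · rw [Set.indicator_of_notMem hx]
      simp only [Set.mem_pi, Set.mem_univ, true_implies, not_forall] at hx
      obtain ⟨i, hi⟩ := hx
      rw [Finset.prod_eq_zero (Finset.mem_univ i) (Set.indicator_of_notMem hi _),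
        ENNReal.ofReal_zero]
  rw [withDensity_apply _ (MeasurableSet.univ_pi hs),
    ← lintegral_indicator (MeasurableSet.univ_pi hs)]
  simp_rw [hind]
  rw [volume_pi, ← ofReal_integral_eq_lintegral_ofReal
    (Integrable.fintype_prod (f := fun i => (s i).indicator (gaussianPDFReal 0 1)) hpdf)
    (ae_of_all _ fun x => Finset.prod_nonneg fun i _ => hnn i _),
    ← volume_pi, integral_fintype_prod_volume_eq_prod (fun i => (s i).indicator (gaussianPDFReal 0 1)),
    ENNReal.ofReal_prod_of_nonneg fun i _ => integral_nonneg (hnn i)]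
  refine Finset.prod_congr rfl fun i _ => ?_
  rw [integral_indicator (hs i), gaussianReal_apply_eq_integral 0 one_ne_zero]

/-- The volume of the unit ball of `ℝᵈ`. -/
noncomputable def unitBallVolume (d : ℕ) : ℝ := √Real.pi ^ d / Real.Gamma (d / 2 + 1)

lemma unitBallVolume_nonneg (d : ℕ) : 0 ≤ unitBallVolume d :=
  div_nonneg (by positivity) (Real.Gamma_pos_of_pos (by positivity)).le

lemma volume_sum_sq_le {d : ℕ} [NeZero d] {r : ℝ} (hr : 0 ≤ r) :
    (volume : Measure (Fin d → ℝ)) {x | ∑ i, x i ^ 2 ≤ r ^ 2} =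
      ENNReal.ofReal (r ^ d * unitBallVolume d) := by
  have h : {x : Fin d → ℝ | ∑ i, x i ^ 2 ≤ r ^ 2} =
      WithLp.toLp 2 ⁻¹' Metric.closedBall (0 : EuclideanSpace ℝ (Fin d)) r := by
    ext x
    simp only [Set.mem_ofPred_eq, Set.mem_preimage, mem_closedBall_zero_iff]
    rw [← abs_of_nonneg (norm_nonneg (WithLp.toLp 2 x)), ← sq_le_sq₀ (abs_nonneg _) hr, sq_abs,
      EuclideanSpace.real_norm_sq_eq]
  rw [h, (PiLp.volume_preserving_toLp (Fin d)).measure_preimage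
    measurableSet_closedBall.nullMeasurableSet, EuclideanSpace.volume_closedBall,
    ENNReal.ofReal_mul (by positivity), ENNReal.ofReal_pow hr, Fintype.card_fin, unitBallVolume]

lemma gaussian_pi_ball_ge {d : ℕ} [NeZero d] {r : ℝ} (hr : 0 ≤ r) :
    (√(2 * Real.pi))⁻¹ ^ d * Real.exp (-r ^ 2 / 2) * (r ^ d * unitBallVolume d) ≤
      (Measure.pi fun _ : Fin d => gaussianReal 0 1).real {x | ∑ i, x i ^ 2 ≤ r ^ 2} := by
  have hm : MeasurableSet {x : Fin d → ℝ | ∑ i, x i ^ 2 ≤ r ^ 2} :=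
    measurableSet_le (by fun_prop) (by fun_prop)
  rw [measureReal_def, ← ENNReal.ofReal_le_iff_le_toReal (measure_ne_top _ _),
    ENNReal.ofReal_mul (by positivity), ← volume_sum_sq_le hr, ← setLIntegral_const,
    gaussian_pi_eq_withDensity, withDensity_apply _ hm]
  refine setLIntegral_mono' hm fun x hx => ENNReal.ofReal_le_ofReal ?_
  simp only [gaussianPDFReal, NNReal.coe_one, mul_one, sub_zero, Finset.prod_mul_distrib,
    Finset.prod_const, Finset.card_univ, Fintype.card_fin, ← Real.exp_sum]
  gcongr
  rw [← Finset.sum_div, Finset.sum_neg_distrib]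
  have : ∑ i, x i ^ 2 ≤ r ^ 2 := hx
  linarith

/-- Induction in steps of two through the functional equation, from `d = 2` (equality) and `d = 3`
(`π ≤ 4`). The inequality fails at `d = 1`. -/
lemma sqrt_pi_div_two_mul_Gamma_le {d : ℕ} (hd : 2 ≤ d) :
    √Real.pi / 2 * Real.Gamma (d / 2) ≤ Real.Gamma ((d + 1) / 2) := by
  induction d using Nat.strong_induction_on with
  | _ d ih =>
    rcases lt_or_ge d 4 with h4 | h4
    · interval_cases d
      · norm_num
        rw [show (3 : ℝ) / 2 = 1 / 2 + 1 by norm_num, Real.Gamma_add_one (by norm_num),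
          Real.Gamma_one_half_eq]
        linarith
      · norm_num
        rw [show (3 : ℝ) / 2 = 1 / 2 + 1 by norm_num, Real.Gamma_add_one (by norm_num),
          Real.Gamma_one_half_eq]
        nlinarith [Real.sq_sqrt Real.pi_pos.le, Real.pi_lt_four]
    · obtain ⟨e, rfl⟩ : ∃ e, d = e + 2 := ⟨d - 2, by omega⟩
      have h := ih e (by omega) (by omega)
      have he : (2 : ℝ) ≤ e := by exact_mod_cast (show 2 ≤ e by omega)
      have hG := Real.Gamma_pos_of_pos (s := ((e : ℝ) + 1) / 2) (by positivity)
      push_cast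
      rw [show ((e : ℝ) + 2) / 2 = e / 2 + 1 by ring, show ((e : ℝ) + 2 + 1) / 2 = (e + 1) / 2 + 1
        by ring, Real.Gamma_add_one (by positivity), Real.Gamma_add_one (by positivity)]
      nlinarith

lemma integral_abs_pow_mul_exp_gaussianReal (d : ℕ) {b : ℝ} (hb : 0 < b) :
    ∫ x, |x| ^ d * Real.exp (-(b - 1 / 2) * x ^ 2) ∂(gaussianReal 0 1) =
      (√(2 * Real.pi))⁻¹ * (b ^ (-((d : ℝ) + 1) / 2) * Real.Gamma ((d + 1) / 2)) := by
  rw [integral_gaussianReal_eq_integral_smul one_ne_zero]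
  have h : ∀ x : ℝ, gaussianPDFReal 0 1 x • (|x| ^ d * Real.exp (-(b - 1 / 2) * x ^ 2)) =
      (√(2 * Real.pi))⁻¹ * (fun y => y ^ (d : ℝ) * Real.exp (-b * y ^ (2 : ℝ))) |x| := by
    intro x
    rw [smul_eq_mul, mul_left_comm, exp_mul_sq_mul_gaussianPDFReal]
    simp only [Real.rpow_natCast, Real.rpow_ofNat, sq_abs]
    ring_nf
  simp_rw [h]
  rw [integral_const_mul, integral_comp_abs
    (f := fun y => y ^ (d : ℝ) * Real.exp (-b * y ^ (2 : ℝ))),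
    integral_rpow_mul_exp_neg_mul_rpow two_pos (by have := d.cast_nonneg (α := ℝ); linarith) hb]
  ring

lemma measureReal_prod_eq_integral {α β : Type*} [MeasurableSpace α] [MeasurableSpace β]
    (μ : Measure α) (ν : Measure β) [IsProbabilityMeasure μ] [IsProbabilityMeasure ν]
    {s : Set (α × β)} (hs : MeasurableSet s) :
    (μ.prod ν).real s = ∫ x, ν.real (Prod.mk x ⁻¹' s) ∂μ := by
  simp only [measureReal_def]
  rw [Measure.prod_apply hs, integral_toReal (measurable_measure_prodMk_left hs).aemeasurable
    (ae_of_all _ fun x => measure_lt_top _ _)]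

lemma integrable_measureReal_prodMk_left {α β : Type*} [MeasurableSpace α] [MeasurableSpace β]
    (μ : Measure α) (ν : Measure β) [IsProbabilityMeasure μ] [IsProbabilityMeasure ν]
    {s : Set (α × β)} (hs : MeasurableSet s) :
    Integrable (fun x => ν.real (Prod.mk x ⁻¹' s)) μ :=
  Measure.integrable_measure_prodMk_left hs (measure_ne_top _ _)

/-- The slice of the cone at first coordinate `x` is a ball of radius `t |x|`. Bounding the Gaussian
density below by its value on the boundary sphere leaves an explicit Gamma integral. -/
lemma axisCone_lower {d : ℕ} (hd : 2 ≤ d) {q : ℝ} (hq : 0 < q) (hq1 : q < 1) :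
    √q ^ d * √(1 - q) / d ≤
      (Measure.pi fun _ => gaussianReal 0 1).real (axisCone d (1 - q)) := by
  have : NeZero d := ⟨by omega⟩
  -- The tangent of the half-angle of the cone.
  set t : ℝ := √(q / (1 - q)) with ht
  have ht2 : t ^ 2 = q / (1 - q) := Real.sq_sqrt (div_nonneg hq.le (by linarith))
  have ht0 : 0 ≤ t := Real.sqrt_nonneg _
  have hm : MeasurableSet {p : ℝ × (Fin d → ℝ) | ∑ i, p.2 i ^ 2 ≤ (t * |p.1|) ^ 2} :=
    measurableSet_le (by fun_prop) (by fun_prop)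
  have hpre : axisCone d (1 - q) = MeasurableEquiv.piFinSuccAbove (fun _ => ℝ) 0 ⁻¹'
      {p : ℝ × (Fin d → ℝ) | ∑ i, p.2 i ^ 2 ≤ (t * |p.1|) ^ 2} := by
    ext x
    simp only [axisCone, Set.mem_ofPred_eq, Set.mem_preimage,
      MeasurableEquiv.piFinSuccAbove_apply, Fin.insertNthEquiv_symm_apply, mul_pow, sq_abs, ht2,
      Fin.sum_univ_succ, Fin.removeNth_zero, Fin.tail]
    rw [div_mul_eq_mul_div, le_div_iff₀ (by linarith)]
    constructor <;> intro h <;> linarith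
  have hmp := measurePreserving_piFinSuccAbove (n := d) (fun _ => gaussianReal 0 1) 0
  rw [hpre, measureReal_def, hmp.measure_preimage hm.nullMeasurableSet, ← measureReal_def,
    measureReal_prod_eq_integral _ _ hm]
  have hb : 0 < 1 / (2 * (1 - q)) := by
    have : 0 < 1 - q := by linarith
    positivity
  have hq' : 0 < 1 - q := by linarith
  have hexp : 1 / (2 * (1 - q)) - 1 / 2 = t ^ 2 / 2 := by
    rw [ht2]
    field_simp
    ring
  calc √q ^ d * √(1 - q) / d
      ≤ ((√(2 * Real.pi))⁻¹ ^ d * t ^ d * unitBallVolume d) *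
        ((√(2 * Real.pi))⁻¹ * ((1 / (2 * (1 - q))) ^ (-((d : ℝ) + 1) / 2) *
          Real.Gamma ((d + 1) / 2))) := by
        have hA : 0 < √(1 - q) := Real.sqrt_pos.mpr hq'
        have hd0 : (0 : ℝ) < d := by exact_mod_cast (show 0 < d by omega)
        have hpow : (1 / (2 * (1 - q))) ^ (-((d : ℝ) + 1) / 2) = (√2 * √(1 - q)) ^ (d + 1) := by
          rw [← Real.sqrt_mul zero_le_two, one_div, Real.inv_rpow (by positivity),
            ← Real.rpow_neg (by positivity), Real.sqrt_eq_rpow, ← Real.rpow_natCast,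
            ← Real.rpow_mul (by positivity)]
          congr 1
          push_cast
          ring
        have hG0 := Real.Gamma_pos_of_pos (s := (d : ℝ) / 2) (by positivity)
        have hpi : 0 < √Real.pi := Real.sqrt_pos.mpr Real.pi_pos
        have h2 : 0 < √(2 : ℝ) := by positivity
        have hG := sqrt_pi_div_two_mul_Gamma_le hd
        have ht' : t = √q / √(1 - q) := Real.sqrt_div hq.le _
        -- The integral equals the claimed bound times a ratio of Gamma values that is at least `1`.
        have hkey : ((√(2 * Real.pi))⁻¹ ^ d * t ^ d * unitBallVolume d) *
            ((√(2 * Real.pi))⁻¹ * ((√2 * √(1 - q)) ^ (d + 1) * Real.Gamma ((d + 1) / 2))) =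
            √q ^ d * √(1 - q) / d *
              (Real.Gamma ((d + 1) / 2) / (√Real.pi / 2 * Real.Gamma (d / 2))) := by
          rw [unitBallVolume, Real.Gamma_add_one (by positivity), ht',
            Real.sqrt_mul zero_le_two, div_pow, inv_pow, mul_pow, mul_pow, pow_succ, pow_succ]
          field_simp
        rw [hpow, hkey]
        exact le_mul_of_one_le_right (by positivity) ((one_le_div (by positivity)).mpr hG)
    _ = ∫ x, ((√(2 * Real.pi))⁻¹ ^ d * t ^ d * unitBallVolume d) *
        (|x| ^ d * Real.exp (-(1 / (2 * (1 - q)) - 1 / 2) * x ^ 2)) ∂(gaussianReal 0 1) := by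
        rw [integral_const_mul, integral_abs_pow_mul_exp_gaussianReal d hb]
    _ ≤ _ := by
        refine integral_mono_of_nonneg (ae_of_all _ fun x => ?_)
          (integrable_measureReal_prodMk_left _ _ hm) (ae_of_all _ fun x => ?_)
        · have := unitBallVolume_nonneg d
          positivity
        · refine le_trans (le_of_eq ?_)
            (gaussian_pi_ball_ge (d := d) (r := t * |x|) (by positivity))
          rw [hexp, mul_pow, mul_pow, sq_abs]
          ring_nf

/-! ### Many draws against one bad set -/

lemma mul_pow_sub_pow_le {p b : ℝ} (hp1 : p ≤ 1) (hb : 0 ≤ b) (hbp : b ≤ p) (L : ℕ) :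
    p * (1 - p + b) ^ L ≤ p * (1 - p) ^ L + b := by
  have hp0 : 0 ≤ p := hb.trans hbp
  -- Convexity in `b`: on `[0, p]` the power lies below its chord.
  have h : p * (1 - p + b) ^ L ≤ p * (1 - p) ^ L + b * (1 - (1 - p) ^ L) := by
    induction L with
    | zero => simp
    | succ L ih =>
      have h1 : 0 ≤ (1 - p) ^ L := pow_nonneg (by linarith) L
      have h2 : (1 - p) ^ L ≤ 1 := pow_le_one₀ (by linarith) (by linarith)
      have h3 := mul_le_mul_of_nonneg_right ih (show 0 ≤ 1 - p + b by linarith)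
      have h4 : 0 ≤ b * (p - b) * (1 - (1 - p) ^ L) :=
        mul_nonneg (mul_nonneg hb (by linarith)) (by linarith)
      rw [pow_succ, pow_succ]
      nlinarith
  have h1 : 0 ≤ (1 - p) ^ L := pow_nonneg (by linarith) L
  nlinarith

/-- Given `u`, if each of `L` independent draws falls in the neighbourhood `R u` with probability
`p`, then all the draws falling there lie in `B` with probability at most `(1 - p) ^ L` plus the
probability of `B`. -/
lemma pi_prod_neighbourhood_le {α : Type*} [MeasurableSpace α] (G : Measure α)
    [IsProbabilityMeasure G] {R : α → α → Prop} (hR : MeasurableSet {z : α × α | R z.1 z.2})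
    (hsymm : ∀ u v, R u v → R v u) {p : ℝ} (hp : 0 < p) (hRp : ∀ᵐ u ∂G, G.real {v | R u v} = p)
    {B : Set α} (hB : MeasurableSet B) (L : ℕ) :
    ((Measure.pi fun _ : Fin L => G).prod G).real {z | ∀ l, R z.2 (z.1 l) → z.1 l ∈ B} ≤
      (1 - p) ^ L + G.real B := by
  have hp1 : p ≤ 1 := by
    obtain ⟨u, hu⟩ := hRp.exists
    exact hu ▸ measureReal_le_one
  have hRu : ∀ u, MeasurableSet {v | R u v} := fun u => measurable_prodMk_left hR
  have hS : MeasurableSet {z : α × (Fin L → α) | ∀ l, R z.1 (z.2 l) → z.2 l ∈ B} := by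
    simp only [Set.ofPred_forall]
    refine MeasurableSet.iInter fun l => ?_
    have h1 : MeasurableSet {z : α × (Fin L → α) | R z.1 (z.2 l)} :=
      hR.preimage (f := fun z : α × (Fin L → α) => (z.1, z.2 l)) (by fun_prop)
    have h2 : MeasurableSet {z : α × (Fin L → α) | z.2 l ∈ B} :=
      ((measurable_pi_apply l).comp measurable_snd) hB
    exact h1.imp h2
  have hT : MeasurableSet {z : α × α | R z.1 z.2 ∧ z.2 ∈ B} := hR.inter (measurable_snd hB)
  have hswap : ((Measure.pi fun _ : Fin L => G).prod G).real
      {z | ∀ l, R z.2 (z.1 l) → z.1 l ∈ B} =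
      (G.prod (Measure.pi fun _ : Fin L => G)).real
        {z | ∀ l, R z.1 (z.2 l) → z.2 l ∈ B} := by
    rw [← Measure.prod_swap, map_measureReal_apply measurable_swap (by exact measurable_swap hS)]
    rfl
  set b : α → ℝ := fun u => G.real {v | R u v ∧ v ∈ B} with hb
  have hbint : Integrable b G := integrable_measureReal_prodMk_left G G hT
  -- Exchange the order of integration: for fixed `v ∈ B`, symmetry of `R` makes the set of `u` with
  -- `R u v` have mass `p`.
  have hbI : ∫ u, b u ∂G ≤ p * G.real B := by
    have h1 : ∫ u, b u ∂G = (G.prod G).real {z : α × α | R z.1 z.2 ∧ z.2 ∈ B} :=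
      (measureReal_prod_eq_integral G G hT).symm
    have h2 : (G.prod G).real {z : α × α | R z.1 z.2 ∧ z.2 ∈ B} =
        (G.prod G).real {z : α × α | R z.2 z.1 ∧ z.1 ∈ B} := by
      conv_lhs => rw [← Measure.prod_swap, map_measureReal_apply measurable_swap hT]
      rfl
    have hT' : MeasurableSet {z : α × α | R z.2 z.1 ∧ z.1 ∈ B} := measurable_swap hT
    rw [h1, h2, measureReal_prod_eq_integral G G hT']
    have h3 : ∀ᵐ v ∂G, G.real (Prod.mk v ⁻¹' {z : α × α | R z.2 z.1 ∧ z.1 ∈ B}) ≤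
        B.indicator (fun _ => p) v := by
      filter_upwards [hRp] with v hv
      by_cases hvB : v ∈ B
      · rw [Set.indicator_of_mem hvB, ← hv]
        exact measureReal_mono fun u hu => hsymm _ _ hu.1
      · rw [Set.indicator_of_notMem hvB]
        refine le_of_eq ?_
        have : Prod.mk v ⁻¹' {z : α × α | R z.2 z.1 ∧ z.1 ∈ B} = ∅ := by
          ext u
          simp [hvB]
        rw [this, measureReal_empty]
    refine (integral_mono_ae (integrable_measureReal_prodMk_left G G hT')
      ((integrable_const p).indicator hB) h3).trans_eq ?_
    rw [integral_indicator hB, setIntegral_const, smul_eq_mul, mul_comm]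
  -- Given `u`, each draw independently either misses `R u` or lands in `R u ∩ B`, with probability
  -- `1 - p + b u`. The factor `p` avoids division and cancels the one in `hbI`.
  have hfib : ∀ᵐ u ∂G, p * (Measure.pi fun _ : Fin L => G).real
      (Prod.mk u ⁻¹' {z : α × (Fin L → α) | ∀ l, R z.1 (z.2 l) → z.2 l ∈ B}) ≤
      p * (1 - p) ^ L + b u := by
    filter_upwards [hRp] with u hu
    have h1 : Prod.mk u ⁻¹' {z : α × (Fin L → α) | ∀ l, R z.1 (z.2 l) → z.2 l ∈ B} =
        Set.univ.pi fun _ : Fin L => {v | R u v → v ∈ B} := by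
      ext v
      simp
    have h2 : G.real {v | R u v → v ∈ B} = 1 - p + b u := by
      have h3 : {v | R u v → v ∈ B} = {v | R u v}ᶜ ∪ {v | R u v ∧ v ∈ B} := by
        ext v
        by_cases h : R u v <;> simp [h]
      rw [h3, measureReal_union (μ := G) (s₁ := {v | R u v}ᶜ) (s₂ := {v | R u v ∧ v ∈ B}) (Set.disjoint_left.mpr fun v (h : ¬ R u v) h' => h h'.1)
        ((hRu u).inter hB), probReal_compl_eq_one_sub (hRu u), hu]
    have h4 : b u ≤ p := hu ▸ measureReal_mono fun v hv => hv.1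
    have h5 : (Measure.pi fun _ : Fin L => G).real
        (Set.univ.pi fun _ : Fin L => {v | R u v → v ∈ B}) = (1 - p + b u) ^ L := by
      rw [← h2, measureReal_def, Measure.pi_pi]
      simp [measureReal_def]
    rw [h1, h5]
    exact mul_pow_sub_pow_le hp1 measureReal_nonneg h4 L
  have hmain : p * ((Measure.pi fun _ : Fin L => G).prod G).real
      {z | ∀ l, R z.2 (z.1 l) → z.1 l ∈ B} ≤ p * ((1 - p) ^ L + G.real B) := by
    rw [hswap, measureReal_prod_eq_integral _ _ hS, ← integral_const_mul]
    calc _ ≤ ∫ u, (p * (1 - p) ^ L + b u) ∂G :=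
          integral_mono_ae ((integrable_measureReal_prodMk_left _ _ hS).const_mul p)
            ((integrable_const _).add hbint) hfib
      _ = p * (1 - p) ^ L + ∫ u, b u ∂G := by
          rw [integral_add (integrable_const _) hbint]
          simp
      _ ≤ _ := by linarith
  exact le_of_mul_le_mul_left hmain hp

/-! ### Deterministic geometry of the residuals -/

lemma norm_sub_starProjection_le {E : Type*} [NormedAddCommGroup E] [InnerProductSpace ℝ E]
    (K : Submodule ℝ E) [K.HasOrthogonalProjection] (y : E) {w : E} (hw : w ∈ K) :
    ‖y - K.starProjection y‖ ≤ ‖y - w‖ := by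
  rw [K.starProjection_minimal]
  exact ciInf_le ⟨0, by rintro _ ⟨x, rfl⟩; exact norm_nonneg _⟩ (⟨w, hw⟩ : K)

/-- If `v` is not too close to the direction of `a = (I - M_K) y`, then `y` stays away from the
span of `K` and `v`. -/
lemma lt_norm_sub_sq {E : Type*} [NormedAddCommGroup E] [InnerProductSpace ℝ E]
    (K : Submodule ℝ E) [K.HasOrthogonalProjection] {q : ℝ} {y v w : E}
    (hv : ¬ (1 - q) * (‖Kᗮ.starProjection y‖ ^ 2 * ‖Kᗮ.starProjection v‖ ^ 2) ≤
      inner ℝ (Kᗮ.starProjection y) v ^ 2) (hw : w ∈ K) (c : ℝ) :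
    q * ‖Kᗮ.starProjection y‖ ^ 2 < ‖y - (w + c • v)‖ ^ 2 := by
  have h1 : ‖Kᗮ.starProjection (y - (w + c • v))‖ ≤ ‖y - (w + c • v)‖ :=
    Kᗮ.norm_starProjection_apply_le _
  have h2 : Kᗮ.starProjection w = 0 := by
    rw [Submodule.starProjection_apply_eq_zero_iff]
    exact K.le_orthogonal_orthogonal hw
  have h3 : inner ℝ (Kᗮ.starProjection y) v =
      inner ℝ (Kᗮ.starProjection y) (Kᗮ.starProjection v) := by
    rw [← Kᗮ.inner_starProjection_left_eq_right,
      Submodule.starProjection_eq_self_iff.mpr (Kᗮ.starProjection_apply_mem y)]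
  rw [map_sub, map_add, map_smul, h2, zero_add] at h1
  rw [h3] at hv
  set a := Kᗮ.starProjection y
  set b := Kᗮ.starProjection v
  -- If `b = 0`, the cone inequality reads `0 ≤ 0`, against `hv`.
  have hb : 0 < ‖b‖ ^ 2 := by
    rcases eq_or_ne b 0 with h | h
    · simp [h] at hv
    · positivity
  have h4 : ‖a - c • b‖ ^ 2 = ‖a‖ ^ 2 - 2 * (c * inner ℝ a b) + c ^ 2 * ‖b‖ ^ 2 := by
    rw [norm_sub_sq_real, inner_smul_right, norm_smul, mul_pow, Real.norm_eq_abs, sq_abs]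
  have h5 : ‖a - c • b‖ ^ 2 ≤ ‖y - (w + c • v)‖ ^ 2 := by gcongr
  refine lt_of_lt_of_le ?_ h5
  -- After multiplication by `‖b‖²`, completing the square in `c` leaves at least `‖a‖²‖b‖² - ⟨a,
  -- b⟩²`.
  refine lt_of_mul_lt_mul_right ?_ hb.le
  rw [h4]
  push Not at hv
  nlinarith [sq_nonneg (c * ‖b‖ ^ 2 - inner ℝ a b)]

lemma exists_norm_sub_smul_sq_le {E : Type*} [NormedAddCommGroup E] [InnerProductSpace ℝ E]
    {r : ℝ} {u v : E} (hv : v ≠ 0) (h : (1 - r) * (‖u‖ ^ 2 * ‖v‖ ^ 2) ≤ inner ℝ u v ^ 2) :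
    ∃ c : ℝ, ‖u - c • v‖ ^ 2 ≤ r * ‖u‖ ^ 2 := by
  have hv' : 0 < ‖v‖ ^ 2 := by positivity
  refine ⟨inner ℝ u v / ‖v‖ ^ 2, ?_⟩
  rw [norm_sub_sq_real, inner_smul_right, norm_smul, mul_pow, Real.norm_eq_abs, sq_abs]
  have e : ‖u‖ ^ 2 - 2 * (inner ℝ u v / ‖v‖ ^ 2 * inner ℝ u v) +
      (inner ℝ u v / ‖v‖ ^ 2) ^ 2 * ‖v‖ ^ 2 = ‖u‖ ^ 2 - inner ℝ u v ^ 2 / ‖v‖ ^ 2 := by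
    field_simp
    ring
  have h' : (1 - r) * ‖u‖ ^ 2 ≤ inner ℝ u v ^ 2 / ‖v‖ ^ 2 := by
    rw [le_div_iff₀ hv']
    linarith
  linarith

section

variable {n k p₁ p₂ : ℕ}

lemma mem_colSpace_fromCols_replicateCol {ι : Type*} [Fintype ι] [DecidableEq ι]
    (A : Matrix (Fin n) ι ℝ) (u x : EuclideanSpace ℝ (Fin n)) :
    x ∈ colSpace (Matrix.fromCols A (Matrix.replicateCol Unit u.ofLp)) ↔
      ∃ w ∈ colSpace A, ∃ c : ℝ, x = w + c • u := by
  have key : ∀ b : ι ⊕ Unit → ℝ,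
      Matrix.toEuclideanLin (Matrix.fromCols A (Matrix.replicateCol Unit u.ofLp))
        (WithLp.toLp 2 b) = Matrix.toEuclideanLin A (WithLp.toLp 2 (b ∘ Sum.inl)) +
          b (Sum.inr ()) • u := by
    intro b
    ext i
    simp [Matrix.toLpLin_apply, Matrix.mulVec, dotProduct, mul_comm]
  constructor
  · rintro ⟨b, rfl⟩
    exact ⟨_, ⟨WithLp.toLp 2 (b.ofLp ∘ Sum.inl), rfl⟩, b.ofLp (Sum.inr ()), key b.ofLp⟩
  · rintro ⟨_, ⟨b, rfl⟩, c, rfl⟩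
    exact ⟨WithLp.toLp 2 (Sum.elim b.ofLp fun _ => c), key _⟩

variable (X : Matrix (Fin n) (Fin p₁) ℝ) (Z : Matrix (Fin n) (Fin p₂) ℝ)

lemma signal_mem_colSpace (τ : Equiv.Perm (Fin n)) (β₁ : Fin p₁ → ℝ) (β₂ : Fin p₂ → ℝ) :
    signal X Z τ β₁ β₂ ∈ colSpace (design X Z τ) :=
  ⟨WithLp.toLp 2 (Sum.elim β₁ β₂), by
    simp [Matrix.toLpLin_apply, design, signal]⟩

lemma projResidual_eq {ι : Type*} [Fintype ι] [DecidableEq ι] (A : Matrix (Fin n) ι ℝ)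
    (v : EuclideanSpace ℝ (Fin n)) : projResidual A v = (colSpace A)ᗮ.starProjection v := by
  rw [projResidual, Submodule.starProjection_orthogonal_val]

/-- The directions that are too close to the signal component orthogonal to the design of `τ`. -/
def badCone (τ₀ : Equiv.Perm (Fin n)) (β₁ : Fin p₁ → ℝ) (β₂ : Fin p₂ → ℝ) (q : ℝ)
    (τ : Equiv.Perm (Fin n)) : Set (EuclideanSpace ℝ (Fin n)) :=
  {v | (1 - q) * (‖projResidual (design X Z τ) (signal X Z τ₀ β₁ β₂)‖ ^ 2 *
    ‖(colSpace (design X Z τ))ᗮ.starProjection v‖ ^ 2) ≤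
      inner ℝ (projResidual (design X Z τ) (signal X Z τ₀ β₁ β₂)) v ^ 2}

/-- Optimality bounds the residual at `τ` by the one at `τ₀`, hence by `σ ‖u - c v‖`. Removing the
noise `σ (u - c v)` costs the same amount again, so the noiseless signal is within `2 σ ‖u - c v‖`
of the span of `W(τ)` and `v`; outside the bad cone this distance is bounded below. -/
lemma lt_of_mem_reproArgmin {τ₀ τ : Equiv.Perm (Fin n)} (hτ₀ : τ₀ ∈ sparsePerms n k)
    {β₁ : Fin p₁ → ℝ} {β₂ : Fin p₂ → ℝ} {σ : ℝ} (hσ : 0 ≤ σ) {u v : EuclideanSpace ℝ (Fin n)}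
    (hτ : τ ∈ reproArgmin k X Z (response X Z τ₀ β₁ β₂ σ u) v) {q r : ℝ}
    (hclose : (1 - r) * (‖u‖ ^ 2 * ‖v‖ ^ 2) ≤ inner ℝ u v ^ 2)
    (hv : v ∉ badCone X Z τ₀ β₁ β₂ q τ) :
    q * ‖projResidual (design X Z τ) (signal X Z τ₀ β₁ β₂)‖ ^ 2 < 4 * σ ^ 2 * r * ‖u‖ ^ 2 := by
  have hv0 : v ≠ 0 := by
    rintro rfl
    exact hv (by simp [badCone])
  obtain ⟨c, hc⟩ := exists_norm_sub_smul_sq_le hv0 hclose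
  have h1 : reproObjective X Z (response X Z τ₀ β₁ β₂ σ u) v τ ≤
      reproObjective X Z (response X Z τ₀ β₁ β₂ σ u) v τ₀ := hτ.2 hτ₀
  simp only [reproObjective] at h1
  have h2 : ‖projResidual (augDesign X Z τ₀ v) (response X Z τ₀ β₁ β₂ σ u)‖ ≤
      σ * ‖u - c • v‖ := by
    have hmem : signal X Z τ₀ β₁ β₂ + (σ * c) • v ∈ colSpace (augDesign X Z τ₀ v) :=
      (mem_colSpace_fromCols_replicateCol _ _ _).mpr
        ⟨_, signal_mem_colSpace X Z τ₀ β₁ β₂, _, rfl⟩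
    refine (norm_sub_starProjection_le _ _ hmem).trans_eq ?_
    rw [response, add_sub_add_left_eq_sub, mul_smul, ← smul_sub, norm_smul, Real.norm_eq_abs,
      abs_of_nonneg hσ]
  obtain ⟨w, hw, b, hwb⟩ := (mem_colSpace_fromCols_replicateCol (design X Z τ) v _).mp
    ((colSpace (augDesign X Z τ v)).starProjection_apply_mem (response X Z τ₀ β₁ β₂ σ u))
  have h3 := lt_norm_sub_sq (colSpace (design X Z τ)) (q := q) (y := signal X Z τ₀ β₁ β₂)
    (v := v) (w := w) (by rw [← projResidual_eq]; exact hv) hw (b - σ * c)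
  rw [← projResidual_eq] at h3
  have h4 : signal X Z τ₀ β₁ β₂ - (w + (b - σ * c) • v) =
      projResidual (augDesign X Z τ v) (response X Z τ₀ β₁ β₂ σ u) - σ • (u - c • v) := by
    rw [projResidual]
    erw [hwb]
    rw [response]
    module
  have h5 : ‖projResidual (augDesign X Z τ v) (response X Z τ₀ β₁ β₂ σ u)‖ ≤
      σ * ‖u - c • v‖ := (pow_le_pow_iff_left₀ (norm_nonneg _) (norm_nonneg _) two_ne_zero).mp h1
        |>.trans h2
  have h6 : ‖signal X Z τ₀ β₁ β₂ - (w + (b - σ * c) • v)‖ ≤ 2 * (σ * ‖u - c • v‖) := by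
    rw [h4]
    refine (norm_sub_le _ _).trans ?_
    rw [norm_smul, Real.norm_eq_abs, abs_of_nonneg hσ]
    linarith
  calc _ < _ := h3
    _ ≤ (2 * (σ * ‖u - c • v‖)) ^ 2 := by gcongr
    _ = 4 * σ ^ 2 * ‖u - c • v‖ ^ 2 := by ring
    _ ≤ 4 * σ ^ 2 * (r * ‖u‖ ^ 2) := by gcongr
    _ = _ := by ring

lemma cMinPartial_le {τ₀ τ : Equiv.Perm (Fin n)} (hτ : τ ∈ sparsePerms n k) (hne : τ ≠ τ₀)
    (β₁ : Fin p₁ → ℝ) (β₂ : Fin p₂ → ℝ) :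
    cMinPartial k X Z τ₀ β₁ β₂ ≤ ‖projResidual (design X Z τ) (signal X Z τ₀ β₁ β₂)‖ ^ 2 /
      ((n : ℝ) * max ((hammingToId τ₀ : ℝ) - (hammingToId τ : ℝ)) 1) := by
  refine ciInf_le (f := fun τ : {τ : Equiv.Perm (Fin n) // τ ∈ sparsePerms n k ∧ τ ≠ τ₀} =>
    ‖projResidual (design X Z τ.1) (signal X Z τ₀ β₁ β₂)‖ ^ 2 /
      ((n : ℝ) * max ((hammingToId τ₀ : ℝ) - (hammingToId τ.1 : ℝ)) 1)) ?_ ⟨τ, hτ, hne⟩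
  exact (Set.finite_range _).bddBelow

lemma mul_cMinPartial_le {τ₀ τ : Equiv.Perm (Fin n)} (hτ : τ ∈ sparsePerms n k) (hne : τ ≠ τ₀)
    {β₁ : Fin p₁ → ℝ} {β₂ : Fin p₂ → ℝ} (hn : 0 < n) (hC : 0 < cMinPartial k X Z τ₀ β₁ β₂) :
    n * cMinPartial k X Z τ₀ β₁ β₂ ≤
      ‖projResidual (design X Z τ) (signal X Z τ₀ β₁ β₂)‖ ^ 2 := by
  have hn' : (0 : ℝ) < n := by exact_mod_cast hn
  have h := cMinPartial_le X Z hτ hne β₁ β₂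
  have hm : 1 ≤ max ((hammingToId τ₀ : ℝ) - (hammingToId τ : ℝ)) 1 := le_max_right _ _
  have hm0 := zero_lt_one.trans_le hm
  rw [le_div_iff₀ (by positivity)] at h
  refine le_trans ?_ h
  rw [mul_comm]
  gcongr
  exact le_mul_of_one_le_right hn'.le hm

/-- A positive separation constant forces a permuted design with at least one column. -/
lemma pos_of_cMinPartial_pos {τ₀ : Equiv.Perm (Fin n)} {β₁ : Fin p₁ → ℝ} {β₂ : Fin p₂ → ℝ}
    (hC : 0 < cMinPartial k X Z τ₀ β₁ β₂) : 0 < p₁ := by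
  by_contra h0
  obtain rfl : p₁ = 0 := by omega
  -- Without competitors the real infimum is `0` by convention; with one, a design independent of
  -- `τ` leaves no residual.
  rcases isEmpty_or_nonempty {τ : Equiv.Perm (Fin n) // τ ∈ sparsePerms n k ∧ τ ≠ τ₀} with h | h
  · rw [cMinPartial, Real.iInf_of_isEmpty] at hC
    exact hC.false
  · obtain ⟨τ, hτ, hne⟩ := h
    have h1 := cMinPartial_le X Z hτ hne β₁ β₂
    have hd : design X Z τ = design X Z τ₀ := by
      ext i j
      rcases j with j | j
      · exact j.elim0
      · rfl
    have h2 : projResidual (design X Z τ) (signal X Z τ₀ β₁ β₂) = 0 := by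
      rw [hd, projResidual,
        Submodule.starProjection_eq_self_iff.mpr (signal_mem_colSpace X Z τ₀ β₁ β₂), sub_self]
    rw [h2] at h1
    simp at h1
    linarith

end

/-! ### Choice of constants and the finite-sample bound -/

section

variable {n k p₁ p₂ : ℕ}

lemma one_le_log_exp_one_div {γ : ℝ} (hγ : 0 < γ) (hγ1 : γ ≤ 1) :
    1 ≤ Real.log (Real.exp 1 / γ) := by
  rw [Real.log_div (Real.exp_ne_zero _) hγ.ne', Real.log_exp]
  linarith [Real.log_nonpos hγ.le hγ1]

lemma mul_log_exp_one_div_le {γ : ℝ} (hγ : 0 < γ) (hγ4 : γ ≤ 1 / 4) :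
    γ * Real.log (Real.exp 1 / γ) ≤ 3 / 4 := by
  have hs : 0 < √γ := Real.sqrt_pos.mpr hγ
  -- Using `log s ≤ s - 1` at `s = 1/√γ` gives the bound `2√γ - γ`, which is at most `3/4` for `√γ ≤
  -- 1/2`.
  have h1 : Real.log (√γ)⁻¹ ≤ (√γ)⁻¹ - 1 := Real.log_le_sub_one_of_pos (by positivity)
  have h2 : √γ ≤ 1 / 2 := Real.sqrt_le_iff.mpr ⟨by norm_num, by linarith⟩
  have h3 : γ = √γ ^ 2 := (Real.sq_sqrt hγ.le).symm
  rw [Real.log_inv] at h1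
  rw [Real.log_div (Real.exp_ne_zero _) hγ.ne', Real.log_exp]
  have h4 : Real.log γ = 2 * Real.log √γ := by
    conv_lhs => rw [h3]
    simp [Real.log_pow]
  rw [h4]
  have h5 : γ * (1 - 2 * Real.log √γ) ≤ γ * (2 * (√γ)⁻¹ - 1) :=
    mul_le_mul_of_nonneg_left (by linarith) hγ.le
  have h6 : γ * (2 * (√γ)⁻¹ - 1) = 2 * √γ - √γ ^ 2 := by
    conv_lhs => rw [h3]
    field_simp
    simp [hs.le]
  rw [h6] at h5
  nlinarith

/-- For `t ≤ 3/4` the base in `axisCone_upper` is at most `t/2`; its factor `1/2` absorbs the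
prefactor `√2`. Allowing `m ≥ d` covers rank-deficient designs, whose orthogonal complement is
larger. -/
lemma gaussian_axisCone_le {d m : ℕ} (hd : 1 ≤ d) (hdm : d ≤ m) {t : ℝ} (ht : 0 < t)
    (ht1 : t ≤ 3 / 4) :
    (Measure.pi fun _ => gaussianReal 0 1).real (axisCone m (1 - 5 / 16 * t ^ 2)) ≤ √t ^ d := by
  have hq : 5 / 16 * t ^ 2 < 1 := by nlinarith
  have hq0 : 0 < 5 / 16 * t ^ 2 := by positivity
  refine (axisCone_upper hq0 hq).trans ?_
  have h1 : 2 * (5 / 16 * t ^ 2) / (1 + 5 / 16 * t ^ 2) ≤ t / 2 := by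
    rw [div_le_iff₀ (by positivity)]
    nlinarith [mul_pos ht ht, mul_pos (mul_pos ht ht) ht]
  have h2 : √(2 * (5 / 16 * t ^ 2) / (1 + 5 / 16 * t ^ 2)) ≤ √t / √2 := by
    rw [← Real.sqrt_div ht.le]
    exact Real.sqrt_le_sqrt h1
  have h3 : √t / √2 ≤ 1 := by
    rw [← Real.sqrt_div ht.le]
    exact Real.sqrt_le_one.mpr (by linarith)
  have h4 : 1 ≤ √(2 : ℝ) := Real.one_le_sqrt.mpr (by norm_num)
  calc √2 * √(2 * (5 / 16 * t ^ 2) / (1 + 5 / 16 * t ^ 2)) ^ m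
      ≤ √2 * (√t / √2) ^ m := by gcongr
    _ ≤ √2 * (√t / √2) ^ d := by
        gcongr √2 * ?_
        exact pow_le_pow_of_le_one (by positivity) h3 hdm
    _ ≤ √2 ^ d * (√t / √2) ^ d := by
        gcongr
        exact le_self_pow₀ h4 (by omega)
    _ = √t ^ d := by
        rw [← mul_pow, mul_div_cancel₀ _ (by positivity)]

/-- The widening factor `5/4` gains `√(5/4) ^ d ≥ 5/4`, which pays for the loss `√(1 - q) ≥ 4/5`. -/
lemma le_gaussian_axisCone {d : ℕ} (hd : 2 ≤ d) {γ : ℝ} (hγ : 0 < γ) (hγ4 : γ ≤ 1 / 4) :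
    γ ^ d / d ≤ (Measure.pi fun _ => gaussianReal 0 1).real (axisCone d (1 - 5 / 4 * γ ^ 2)) := by
  have hd0 : (0 : ℝ) < d := by exact_mod_cast (show 0 < d by omega)
  have hγ2 : γ ^ 2 ≤ 1 / 16 := by nlinarith
  refine le_trans ?_ (axisCone_lower hd (q := 5 / 4 * γ ^ 2) (by positivity) (by linarith))
  rw [Real.sqrt_mul (by norm_num), Real.sqrt_sq hγ.le, mul_pow]
  have h1 : 5 / 4 ≤ √(5 / 4 : ℝ) ^ d := by
    calc (5 / 4 : ℝ) = √(5 / 4 : ℝ) ^ 2 := (Real.sq_sqrt (by norm_num)).symm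
      _ ≤ _ := pow_le_pow_right₀ (Real.one_le_sqrt.mpr (by norm_num)) hd
  have h2 : 4 / 5 ≤ √(1 - 5 / 4 * γ ^ 2) := Real.le_sqrt_of_sq_le (by linarith)
  have h3 : 0 < γ ^ d := by positivity
  gcongr
  nlinarith [mul_le_mul h1 h2 (by norm_num) (by positivity)]

variable (X : Matrix (Fin n) (Fin p₁) ℝ) (Z : Matrix (Fin n) (Fin p₂) ℝ)

lemma finrank_colSpace_orthogonal_ge (τ : Equiv.Perm (Fin n)) :
    n ≤ Module.finrank ℝ (colSpace (design X Z τ))ᗮ + (p₁ + p₂) := by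
  have h1 := (colSpace (design X Z τ)).finrank_add_finrank_orthogonal
  have h2 : Module.finrank ℝ (colSpace (design X Z τ)) ≤ p₁ + p₂ := by
    refine (LinearMap.finrank_range_le _).trans_eq ?_
    simp
  rw [finrank_euclideanSpace_fin] at h1
  omega

lemma measurableSet_badCone (τ₀ τ : Equiv.Perm (Fin n)) (β₁ : Fin p₁ → ℝ) (β₂ : Fin p₂ → ℝ)
    (q : ℝ) : MeasurableSet (badCone X Z τ₀ β₁ β₂ q τ) :=
  measurableSet_le (by fun_prop) (by fun_prop)

lemma stdGaussian_badCone_le {τ₀ τ : Equiv.Perm (Fin n)} {β₁ : Fin p₁ → ℝ} {β₂ : Fin p₂ → ℝ}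
    (hn : p₁ + p₂ + 1 < n)
    (h0 : projResidual (design X Z τ) (signal X Z τ₀ β₁ β₂) ≠ 0)
    {t : ℝ} (ht : 0 < t) (ht1 : t ≤ 3 / 4) :
    (stdGaussian (EuclideanSpace ℝ (Fin n))).real
      (badCone X Z τ₀ β₁ β₂ (5 / 16 * t ^ 2) τ) ≤ √t ^ (n - (p₁ + p₂) - 1) := by
  have hrank := finrank_colSpace_orthogonal_ge X Z τ
  obtain ⟨m, hm⟩ : ∃ m, Module.finrank ℝ (colSpace (design X Z τ))ᗮ = m + 1 :=
    ⟨Module.finrank ℝ (colSpace (design X Z τ))ᗮ - 1, by omega⟩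
  rw [badCone, stdGaussian_subspace_cone_eq _ hm _ _ h0]
  · exact gaussian_axisCone_le (by omega) (by omega) ht ht1
  · rw [projResidual_eq]
    exact Submodule.starProjection_apply_mem _ _

lemma one_le_sum_choose_mul_numDerangements (n k : ℕ) :
    (1 : ℝ) ≤ ∑ m ∈ Finset.Icc (n - k) n, (n.choose m : ℝ) * (numDerangements (n - m) : ℝ) := by
  refine le_trans ?_ (Finset.single_le_sum (f := fun m =>
    (n.choose m : ℝ) * (numDerangements (n - m) : ℝ)) (fun m _ => by positivity)
    (Finset.right_mem_Icc.mpr (Nat.sub_le n k)))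
  simp

lemma ae_stdGaussian_ne_zero (d : ℕ) :
    ∀ᵐ u ∂(stdGaussian (EuclideanSpace ℝ (Fin (d + 1)))), u ≠ 0 := by
  have : NullSingletonClass (gaussianReal 0 1) :=
    nullSingletonClass_gaussianReal one_ne_zero
  have := Measure.pi_nullSingletonClass (μ := fun _ : Fin (d + 1) => gaussianReal 0 1) 0
  have hm : MeasurableSet {u : EuclideanSpace ℝ (Fin (d + 1)) | u ≠ 0} :=
    (measurableSet_singleton 0).compl
  rw [← map_pi_eq_stdGaussian, ae_map_iff (by fun_prop) hm]
  filter_upwards [Measure.ae_ne _ (0 : Fin (d + 1) → ℝ)] with x hx h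
  exact hx (by simpa using congrArg WithLp.ofLp h)

theorem measureReal_notMem_candidateSet_le
    {τ₀ : Equiv.Perm (Fin n)} (hτ₀ : τ₀ ∈ sparsePerms n k)
    {β₁ : Fin p₁ → ℝ} {β₂ : Fin p₂ → ℝ} {σ₀ : ℝ} (hσ₀ : 0 < σ₀)
    {C : ℝ} (hC : C = cMinPartial k X Z τ₀ β₁ β₂) (hCpos : 0 < C)
    (hn : p₁ + p₂ + 1 < n) {L : ℕ} {Ω : Type*} [MeasurableSpace Ω] {P : Measure Ω}
    [IsProbabilityMeasure P] {Ustar : Fin L → Ω → EuclideanSpace ℝ (Fin n)}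
    {U : Ω → EuclideanSpace ℝ (Fin n)}
    (hlaw : HasLaw (fun ω => ((fun l => Ustar l ω), U ω)) (noiseLaw n L) P)
    {τhat : Fin L → Ω → Equiv.Perm (Fin n)}
    (hτhat : ∀ l ω, τhat l ω ∈ reproArgmin k X Z
      (response X Z τ₀ β₁ β₂ σ₀ (U ω)) (Ustar l ω))
    {γ : ℝ} (hγ : 0 < γ) (hγ4 : γ ≤ 1 / 4) :
    P.real {ω | τ₀ ∉ candidateSet k fun l => τhat l ω} ≤
      Delta n k (p₁ + p₂) C σ₀ γ + (1 - γ ^ (n - 1) / ((n : ℝ) - 1)) ^ L := by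
  -- This forces `n ≥ 3`, so `d = n - 1 ≥ 2` as the lower cone bound requires.
  have hp₁ : 0 < p₁ := pos_of_cMinPartial_pos X Z (hC ▸ hCpos)
  obtain ⟨d, rfl⟩ : ∃ d, n = d + 1 := ⟨n - 1, by omega⟩
  have hnpos : (0 : ℝ) < ((d + 1 : ℕ) : ℝ) := by positivity
  set G := stdGaussian (EuclideanSpace ℝ (Fin (d + 1))) with hG
  set lg := Real.log (Real.exp 1 / γ) with hlg
  have hlg1 : 1 ≤ lg := one_le_log_exp_one_div hγ (by linarith)
  set t := γ * lg with ht
  have ht0 : 0 < t := by positivity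
  have ht1 : t ≤ 3 / 4 := mul_log_exp_one_div_le hγ hγ4
  set x := C * lg ^ 2 / (16 * σ₀ ^ 2) with hx
  let R : EuclideanSpace ℝ (Fin (d + 1)) → EuclideanSpace ℝ (Fin (d + 1)) → Prop :=
    fun u v => (1 - 5 / 4 * γ ^ 2) * (‖u‖ ^ 2 * ‖v‖ ^ 2) ≤ inner ℝ u v ^ 2
  let T : Finset (Equiv.Perm (Fin (d + 1))) := (sparsePerms (d + 1) k).erase τ₀
  let B : Set (EuclideanSpace ℝ (Fin (d + 1))) :=
    ⋃ τ ∈ T, badCone X Z τ₀ β₁ β₂ (5 / 16 * t ^ 2) τ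
  have hres : ∀ τ ∈ T, ((d + 1 : ℕ) : ℝ) * C ≤
      ‖projResidual (design X Z τ) (signal X Z τ₀ β₁ β₂)‖ ^ 2 := fun τ hτ => by
    rw [hC]
    exact mul_cMinPartial_le X Z (Finset.mem_of_mem_erase hτ) (Finset.ne_of_mem_erase hτ)
      (by omega) (hC ▸ hCpos)
  have hBm : MeasurableSet B :=
    Finset.measurableSet_biUnion _ fun τ _ => measurableSet_badCone X Z τ₀ τ β₁ β₂ _
  have hBle : G.real B ≤ (sparsePerms (d + 1) k).card * √t ^ (d + 1 - (p₁ + p₂) - 1) := by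
    refine (measureReal_biUnion_finset_le _ _).trans ?_
    refine (Finset.sum_le_card_nsmul T _ (√t ^ (d + 1 - (p₁ + p₂) - 1)) fun τ hτ => ?_).trans ?_
    · refine stdGaussian_badCone_le X Z hn (fun h => ?_) ht0 ht1
      have := hres τ hτ
      rw [h, norm_zero, zero_pow two_ne_zero] at this
      nlinarith [mul_pos hnpos hCpos]
    · rw [nsmul_eq_mul]
      gcongr
      exact Finset.erase_subset _ _
  have hRm : MeasurableSet {z : EuclideanSpace ℝ (Fin (d + 1)) × EuclideanSpace ℝ (Fin (d + 1)) |
      R z.1 z.2} := measurableSet_le (by fun_prop) (by fun_prop)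
  have hRsymm : ∀ u v, R u v → R v u := fun u v h => by
    simp only [R] at h ⊢
    rwa [real_inner_comm, mul_comm (‖v‖ ^ 2)]
  set p := (Measure.pi fun _ => gaussianReal 0 1).real (axisCone d (1 - 5 / 4 * γ ^ 2)) with hp
  have hple : γ ^ d / d ≤ p := le_gaussian_axisCone (by omega) hγ hγ4
  have hd0 : (0 : ℝ) < d := by exact_mod_cast (show 0 < d by omega)
  have hp0 : 0 < p := lt_of_lt_of_le (by positivity) hple
  have hRp : ∀ᵐ u ∂G, G.real {v | R u v} = p := by
    have h0 : ∀ᵐ u ∂G, u ≠ 0 := ae_stdGaussian_ne_zero d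
    filter_upwards [h0] with u hu
    exact stdGaussian_cone_eq (by simp) _ hu
  have hA4 := pi_prod_neighbourhood_le G hRm hRsymm hp0 hRp hBm L
  have hAm : MeasurableSet {z : (Fin L → EuclideanSpace ℝ (Fin (d + 1))) ×
      EuclideanSpace ℝ (Fin (d + 1)) | ∀ l, R z.2 (z.1 l) → z.1 l ∈ B} := by
    simp only [Set.ofPred_forall]
    refine MeasurableSet.iInter fun l => ?_
    have h1 := hRm.preimage (f := fun z : (Fin L → EuclideanSpace ℝ (Fin (d + 1))) ×
      EuclideanSpace ℝ (Fin (d + 1)) => (z.2, z.1 l)) (by fun_prop)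
    exact h1.imp (((measurable_pi_apply l).comp measurable_fst) hBm)
  have hNm : MeasurableSet {z : (Fin L → EuclideanSpace ℝ (Fin (d + 1))) ×
      EuclideanSpace ℝ (Fin (d + 1)) | ((d + 1 : ℕ) : ℝ) * x ≤ ‖z.2‖ ^ 2} :=
    measurableSet_le (by fun_prop) (by fun_prop)
  have hN : (noiseLaw (d + 1) L).real {z | ((d + 1 : ℕ) : ℝ) * x ≤ ‖z.2‖ ^ 2} ≤
      Real.exp (-(((d + 1 : ℕ) : ℝ) / 2) * Psi (max 1 x)) := by
    refine le_trans (le_of_eq ?_) (stdGaussian_norm_sq_ge_le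
      (E := EuclideanSpace ℝ (Fin (d + 1))) finrank_euclideanSpace_fin x)
    rw [noiseLaw, measureReal_def, measureReal_def]
    congr 1
    have hm : MeasurableSet {v : EuclideanSpace ℝ (Fin (d + 1)) |
        ((d + 1 : ℕ) : ℝ) * x ≤ ‖v‖ ^ 2} := measurableSet_le (by fun_prop) (by fun_prop)
    exact measurePreserving_snd.measure_preimage hm.nullMeasurableSet
  have hsub : {ω | τ₀ ∉ candidateSet k fun l => τhat l ω} ⊆
      {ω | ((d + 1 : ℕ) : ℝ) * x ≤ ‖U ω‖ ^ 2} ∪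
        {ω | ∀ l, R (U ω) (Ustar l ω) → Ustar l ω ∈ B} := by
    intro ω hω
    by_contra hcon
    simp only [Set.mem_union, Set.mem_ofPred_eq, not_or, not_le, not_forall] at hcon
    obtain ⟨hU, l, hRl, hBl⟩ := hcon
    refine hω ⟨hτ₀, l, ?_⟩
    by_contra hne
    have hmem : τhat l ω ∈ T := Finset.mem_erase.mpr ⟨hne, (hτhat l ω).1⟩
    have hcone : Ustar l ω ∉ badCone X Z τ₀ β₁ β₂ (5 / 16 * t ^ 2) (τhat l ω) :=
      fun h => hBl (Set.mem_biUnion hmem h)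
    have h1 := lt_of_mem_reproArgmin X Z hτ₀ hσ₀.le (hτhat l ω) hRl hcone
    have h2 := hres _ hmem
    -- The two sides are equal by the choice of `x`: with `t = γ lg`, `5/16` is the cone parameter
    -- matching the closeness `5/4 γ²` and the `16` in the exponential.
    have h3 : 5 / 16 * t ^ 2 * (((d + 1 : ℕ) : ℝ) * C) <
        4 * σ₀ ^ 2 * (5 / 4 * γ ^ 2) * (((d + 1 : ℕ) : ℝ) * x) :=
      calc _ ≤ _ := mul_le_mul_of_nonneg_left h2 (by positivity)
        _ < _ := h1
        _ ≤ _ := mul_le_mul_of_nonneg_left hU.le (by positivity)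
    refine h3.ne ?_
    rw [ht, hx]
    field_simp
  have hP : P.real {ω | τ₀ ∉ candidateSet k fun l => τhat l ω} ≤
      Real.exp (-(((d + 1 : ℕ) : ℝ) / 2) * Psi (max 1 x)) + ((1 - p) ^ L + G.real B) := by
    refine (measureReal_mono hsub).trans ((measureReal_union_le _ _).trans ?_)
    refine add_le_add ((hlaw.measureReal_eq hNm).trans_le hN) ((hlaw.measureReal_eq hAm).trans_le ?_)
    exact hA4
  have hpow : (1 - p) ^ L ≤ (1 - γ ^ (d + 1 - 1) / (((d + 1 : ℕ) : ℝ) - 1)) ^ L := by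
    have : p ≤ 1 := measureReal_le_one
    have e : (((d + 1 : ℕ) : ℝ) - 1) = d := by push_cast; ring
    rw [e, Nat.add_sub_cancel]
    gcongr
  refine hP.trans ?_
  rw [Delta, ← hlg, ← hx, ← ht]
  have h1 := one_le_sum_choose_mul_numDerangements (d + 1) k
  have hcast : ((d + 1 : ℕ) : ℝ) - ((p₁ + p₂ : ℕ) : ℝ) - 1 =
      ((d + 1 - (p₁ + p₂) - 1 : ℕ) : ℝ) := by
    rw [Nat.cast_sub (by omega), Nat.cast_sub (by omega)]
    simp
  have h2 : (sparsePerms (d + 1) k).card * √t ^ (d + 1 - (p₁ + p₂) - 1) ≤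
      (Real.pi / 2) ^ (((d + 1 : ℕ) : ℝ) - ((p₁ + p₂ : ℕ) : ℝ) - 2) *
        ((sparsePerms (d + 1) k).card : ℝ) *
        t ^ ((((d + 1 : ℕ) : ℝ) - ((p₁ + p₂ : ℕ) : ℝ) - 1) / 2) := by
    have e1 : t ^ ((((d + 1 : ℕ) : ℝ) - ((p₁ + p₂ : ℕ) : ℝ) - 1) / 2) =
        √t ^ (d + 1 - (p₁ + p₂) - 1) := by
      rw [hcast, Real.sqrt_eq_rpow, ← Real.rpow_natCast, ← Real.rpow_mul ht0.le]
      congr 1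
      ring
    -- The power of `π/2` is pure slack, as are the combinatorial sum (its term `m = n` is already
    -- `1`) and the first exponential.
    have e2 : 1 ≤ (Real.pi / 2) ^ (((d + 1 : ℕ) : ℝ) - ((p₁ + p₂ : ℕ) : ℝ) - 2) := by
      refine Real.one_le_rpow (by linarith [Real.pi_gt_three]) ?_
      have : ((p₁ + p₂ + 2 : ℕ) : ℝ) ≤ ((d + 1 : ℕ) : ℝ) := by exact_mod_cast hn
      push_cast at this ⊢
      linarith
    rw [e1, mul_assoc]
    exact le_mul_of_one_le_left (by positivity) e2
  have h3 : Real.exp (-(((d + 1 : ℕ) : ℝ) / 2) * Psi (max 1 x)) ≤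
      (∑ m ∈ Finset.Icc (d + 1 - k) (d + 1),
        ((d + 1).choose m : ℝ) * (numDerangements (d + 1 - m) : ℝ)) *
      (Real.exp (-(((d + 1 : ℕ) : ℝ) / 2) * Psi (max 1 (C * lg / (2 * σ₀ ^ 2 * γ)))) +
        Real.exp (-(((d + 1 : ℕ) : ℝ) / 2) * Psi (max 1 x))) := by
    refine le_trans ?_ (le_mul_of_one_le_left (by positivity) h1)
    linarith [Real.exp_pos (-(((d + 1 : ℕ) : ℝ) / 2) * Psi (max 1 (C * lg / (2 * σ₀ ^ 2 * γ))))]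
  linarith

end

/-! ### The rate as `L → ∞` -/

lemma gammaSeq_pos {n L : ℕ} (hn : 2 ≤ n) (hL : 1 ≤ L) : 0 < gammaSeq n L := by
  have hn' : (2 : ℝ) ≤ n := by exact_mod_cast hn
  have hL' : (1 : ℝ) ≤ L := by exact_mod_cast hL
  have h : 0 < Real.log (Real.exp 1 * L) := by
    rw [Real.log_mul (Real.exp_ne_zero _) (by positivity), Real.log_exp]
    linarith [Real.log_nonneg hL']
  refine lt_min (by norm_num) (Real.rpow_pos_of_pos ?_ _)
  have : 0 < (n : ℝ) - 1 := by linarith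
  positivity

lemma gammaSeq_le (n L : ℕ) : gammaSeq n L ≤ 1 / 4 := min_le_left _ _

lemma tendsto_log_natCast_atTop : Tendsto (fun L : ℕ => Real.log (L : ℝ)) atTop atTop :=
  Real.tendsto_log_atTop.comp tendsto_natCast_atTop_atTop

lemma tendsto_log_exp_mul_div : Tendsto
    (fun L : ℕ => Real.log (Real.exp 1 * (L : ℝ)) / (L : ℝ)) atTop (nhds 0) := by
  have h : Tendsto (fun x : ℝ => Real.log x / x) atTop (nhds 0) := by
    simpa using Real.isLittleO_log_id_atTop.tendsto_div_nhds_zero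
  have h1 : Tendsto (fun L : ℕ => Real.exp 1 * (L : ℝ)) atTop atTop :=
    tendsto_natCast_atTop_atTop.const_mul_atTop (Real.exp_pos 1)
  have h2 := (h.comp h1).const_mul (Real.exp 1)
  rw [mul_zero] at h2
  refine h2.congr fun L => ?_
  simp only [Function.comp]
  have := Real.exp_pos 1
  field_simp

lemma eventually_gammaSeq_eq {n : ℕ} (hn : 2 ≤ n) : ∀ᶠ L : ℕ in atTop, gammaSeq n L =
    (((n : ℝ) - 1) * Real.log (Real.exp 1 * (L : ℝ)) / (L : ℝ)) ^ (1 / ((n : ℝ) - 1)) := by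
  have hn' : (2 : ℝ) ≤ n := by exact_mod_cast hn
  have h0 : 0 < 1 / ((n : ℝ) - 1) := one_div_pos.mpr (by linarith)
  have h1 := (tendsto_log_exp_mul_div.const_mul ((n : ℝ) - 1)).rpow_const
    (p := 1 / ((n : ℝ) - 1)) (Or.inr h0.le)
  rw [mul_zero, Real.zero_rpow h0.ne'] at h1
  filter_upwards [h1.eventually (ge_mem_nhds (show (0 : ℝ) < 1 / 4 by norm_num))] with L hL
  rw [gammaSeq, min_eq_right]
  rwa [mul_div_assoc]

/-- Once the cap `1/4` is inactive, `log (e/γ_L) = 1 + (log L - log ν - log (1 + log L))/ν` with `ν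
= n - 1`, and the subtracted terms are eventually at most half of `log L`. -/
lemma eventually_log_exp_one_div_gammaSeq {n : ℕ} (hn : 2 ≤ n) :
    ∀ᶠ L : ℕ in atTop, Real.log (L : ℝ) / (2 * ((n : ℝ) - 1)) ≤
      Real.log (Real.exp 1 / gammaSeq n L) ∧
      Real.log (Real.exp 1 / gammaSeq n L) ≤ 2 * Real.log (L : ℝ) := by
  have hn' : (2 : ℝ) ≤ n := by exact_mod_cast hn
  set ν : ℝ := (n : ℝ) - 1 with hν
  have hν1 : 1 ≤ ν := by linarith
  have hsmall : ∀ᶠ x : ℝ in atTop, Real.log ν + Real.log (1 + x) ≤ x / 2 := by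
    have h1 : Tendsto (fun x : ℝ => 1 + x) atTop atTop := tendsto_atTop_add_const_left _ _ tendsto_id
    have h2 := h1.eventually (Real.isLittleO_log_id_atTop.bound (show (0 : ℝ) < 1 / 4 by norm_num))
    filter_upwards [h2, eventually_ge_atTop (0 : ℝ), eventually_ge_atTop (4 * Real.log ν + 1)]
      with x hx hx0 hx1
    simp only [id, Real.norm_eq_abs] at hx
    rw [abs_of_nonneg (by linarith : (0 : ℝ) ≤ 1 + x)] at hx
    linarith [le_abs_self (Real.log (1 + x))]
  filter_upwards [eventually_gammaSeq_eq hn, tendsto_log_natCast_atTop.eventually hsmall,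
    tendsto_log_natCast_atTop.eventually_ge_atTop 1, eventually_ge_atTop 1] with L h1 h2 h3 h4
  have hL : (0 : ℝ) < L := by exact_mod_cast h4
  have hle : Real.log (Real.exp 1 * L) = 1 + Real.log L := by
    rw [Real.log_mul (Real.exp_ne_zero _) hL.ne', Real.log_exp]
  have e : Real.log (Real.exp 1 / gammaSeq n L) =
      1 + (Real.log L - Real.log ν - Real.log (1 + Real.log L)) / ν := by
    rw [Real.log_div (Real.exp_ne_zero _) (gammaSeq_pos hn h4).ne', Real.log_exp, h1, ← hν, hle,
      Real.log_rpow (by positivity), Real.log_div (by positivity) hL.ne',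
      Real.log_mul (by positivity) (by positivity)]
    ring
  have hν0 : 0 ≤ Real.log ν := Real.log_nonneg hν1
  have hl0 : 0 ≤ Real.log (1 + Real.log L) := Real.log_nonneg (by linarith)
  rw [e]
  constructor
  · have : Real.log L / (2 * ν) = Real.log L / 2 / ν := (div_div _ _ _).symm
    rw [this]
    have : Real.log L / 2 / ν ≤ (Real.log L - Real.log ν - Real.log (1 + Real.log L)) / ν := by
      gcongr
      linarith
    linarith
  · have : (Real.log L - Real.log ν - Real.log (1 + Real.log L)) / ν ≤ Real.log L := by
      rw [div_le_iff₀ (by linarith)]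
      nlinarith
    linarith

lemma exp_neg_mul_Psi_le {a x y : ℝ} (ha : 0 ≤ a) (hxy : y ≤ x) :
    Real.exp (-a * Psi (max 1 x)) ≤ Real.exp a * Real.exp (-(a / 2 * y)) := by
  rw [← Real.exp_add, Real.exp_le_exp]
  set z := max 1 x
  have hz : 1 ≤ z := le_max_left _ _
  have hyz : y ≤ z := hxy.trans (le_max_right _ _)
  -- This gives the linear bound `Ψ(z) ≥ z/2 - 1`, enough for a rate.
  have hlog : Real.log z ≤ z / 2 := by
    have h := Real.log_le_sub_one_of_pos (show 0 < z / 2 by linarith)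
    rw [Real.log_div (by linarith) two_ne_zero] at h
    linarith [Real.log_two_lt_d9]
  have hPsi : y / 2 - 1 ≤ Psi z := by
    rw [Psi]
    linarith
  nlinarith [mul_le_mul_of_nonneg_left hPsi ha]

lemma exp_neg_mul_log_sq_isBigO {c : ℝ} (hc : 0 < c) :
    (fun L : ℕ => Real.exp (-(c * Real.log (L : ℝ) ^ 2))) =O[atTop] fun L : ℕ => (L : ℝ)⁻¹ := by
  refine IsBigO.of_bound 1 ?_
  filter_upwards [tendsto_log_natCast_atTop.eventually_ge_atTop 1, eventually_ge_atTop 1,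
    tendsto_log_natCast_atTop.eventually_ge_atTop c⁻¹] with L h1 h2 h3
  have hL : (0 : ℝ) < L := by exact_mod_cast h2
  rw [Real.norm_of_nonneg (by positivity), Real.norm_of_nonneg (by positivity), one_mul,
    ← Real.exp_log (inv_pos.mpr hL), Real.log_inv, Real.exp_le_exp]
  have : 1 ≤ c * Real.log L := by
    rwa [inv_le_iff_one_le_mul₀' hc] at h3
  nlinarith

lemma inv_isBigO_log_rpow_div_rpow {a b : ℝ} (ha : a ≤ 1) (hb : 0 ≤ b) :
    (fun L : ℕ => (L : ℝ)⁻¹) =O[atTop] fun L : ℕ => Real.log (L : ℝ) ^ b / (L : ℝ) ^ a := by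
  refine IsBigO.of_bound 1 ?_
  filter_upwards [tendsto_log_natCast_atTop.eventually_ge_atTop 1, eventually_ge_atTop 1]
    with L h1 h2
  have hL : (1 : ℝ) ≤ L := by exact_mod_cast h2
  have h0 : 0 ≤ Real.log (L : ℝ) := by linarith
  rw [Real.norm_of_nonneg (by positivity), Real.norm_of_nonneg (by positivity), one_mul,
    ← one_div]
  have h3 : (L : ℝ) ^ a ≤ L := by
    simpa using Real.rpow_le_rpow_of_exponent_le hL ha
  have h4 := Real.one_le_rpow h1 hb
  gcongr

lemma exp_neg_mul_Psi_isBigO {n : ℕ} (hn : 2 ≤ n) {C σ : ℝ} (hC : 0 < C) (hσ : 0 < σ)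
    {x : ℕ → ℝ}
    (hx : ∀ L, 2 ≤ L → C * Real.log (Real.exp 1 / gammaSeq n L) ^ 2 / (16 * σ ^ 2) ≤ x L) :
    (fun L : ℕ => Real.exp (-((n : ℝ) / 2) * Psi (max 1 (x L)))) =O[atTop]
      fun L : ℕ => (L : ℝ)⁻¹ := by
  have hn' : (2 : ℝ) ≤ n := by exact_mod_cast hn
  have hν : 0 < (n : ℝ) - 1 := by linarith
  set c : ℝ := n / 2 / 2 * (C * (1 / (2 * ((n : ℝ) - 1))) ^ 2 / (16 * σ ^ 2)) with hc
  have hc0 : 0 < c := by positivity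
  refine IsBigO.trans (IsBigO.of_bound (Real.exp (n / 2)) ?_) (exp_neg_mul_log_sq_isBigO hc0)
  filter_upwards [eventually_log_exp_one_div_gammaSeq hn, eventually_ge_atTop 2,
    tendsto_log_natCast_atTop.eventually_ge_atTop 1] with L h1 h2 h3
  rw [Real.norm_of_nonneg (by positivity), Real.norm_of_nonneg (by positivity)]
  have hy : C * (Real.log L / (2 * ((n : ℝ) - 1))) ^ 2 / (16 * σ ^ 2) ≤ x L := by
    refine le_trans ?_ (hx L h2)
    have := h1.1
    gcongr
  refine (exp_neg_mul_Psi_le (by positivity) hy).trans_eq ?_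
  rw [hc]
  ring_nf

lemma one_sub_pow_isBigO {n : ℕ} (hn : 2 ≤ n) :
    (fun L : ℕ => (1 - gammaSeq n L ^ (n - 1) / ((n : ℝ) - 1)) ^ L) =O[atTop]
      fun L : ℕ => (L : ℝ)⁻¹ := by
  have hn' : (2 : ℝ) ≤ n := by exact_mod_cast hn
  refine IsBigO.of_bound 1 ?_
  filter_upwards [eventually_gammaSeq_eq hn, eventually_ge_atTop 1,
    tendsto_log_exp_mul_div.eventually (ge_mem_nhds zero_lt_one)] with L h1 h2 h3
  have hL : (1 : ℝ) ≤ L := by exact_mod_cast h2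
  have hL0 : (0 : ℝ) < L := by linarith
  have hν : 0 < (n : ℝ) - 1 := by linarith
  have hle : Real.log (Real.exp 1 * L) = 1 + Real.log L := by
    rw [Real.log_mul (Real.exp_ne_zero _) hL0.ne', Real.log_exp]
  have hl := Real.log_nonneg hL
  -- The purpose of `γ_L`: the hitting bound becomes `log (e L) / L`, so `L` misses cost at most
  -- `1/(e L)`.
  have e : gammaSeq n L ^ (n - 1) / ((n : ℝ) - 1) = Real.log (Real.exp 1 * L) / L := by
    rw [h1, ← Real.rpow_natCast, ← Real.rpow_mul (by rw [hle]; positivity),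
      Nat.cast_sub (by omega), Nat.cast_one, one_div_mul_cancel hν.ne', Real.rpow_one]
    field_simp
  rw [e, Real.norm_of_nonneg (pow_nonneg (by linarith) _), Real.norm_of_nonneg (by positivity),
    one_mul]
  calc (1 - Real.log (Real.exp 1 * L) / L) ^ L
      ≤ Real.exp (-(Real.log (Real.exp 1 * L) / L)) ^ L := by
        refine pow_le_pow_left₀ (by linarith) ?_ L
        linarith [Real.add_one_le_exp (-(Real.log (Real.exp 1 * L) / L))]
    _ = Real.exp (-Real.log (Real.exp 1 * L)) := by
        rw [← Real.exp_nat_mul]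
        congr 1
        field_simp
    _ ≤ Real.exp (-Real.log L) := by
        rw [Real.exp_le_exp, hle]
        linarith
    _ = (L : ℝ)⁻¹ := by rw [Real.exp_neg, Real.exp_log hL0]

lemma gammaSeq_mul_log_rpow_isBigO {n : ℕ} (hn : 2 ≤ n) {D : ℝ} (hD : 0 ≤ D)
    (hDn : D ≤ (n : ℝ) - 1) :
    (fun L : ℕ => (gammaSeq n L * Real.log (Real.exp 1 / gammaSeq n L)) ^ (D / 2)) =O[atTop]
      fun L : ℕ => Real.log (L : ℝ) ^ ((D + 1) / 2) / (L : ℝ) ^ (D / (2 * ((n : ℝ) - 1))) := by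
  have hn' : (2 : ℝ) ≤ n := by exact_mod_cast hn
  have hν : 0 < (n : ℝ) - 1 := by linarith
  set ν : ℝ := (n : ℝ) - 1 with hνdef
  refine IsBigO.of_bound (((ν * 2) ^ (1 / ν) * 2) ^ (D / 2)) ?_
  filter_upwards [eventually_gammaSeq_eq hn, eventually_ge_atTop 1,
    eventually_log_exp_one_div_gammaSeq hn,
    tendsto_log_natCast_atTop.eventually_ge_atTop 1] with L h1 h2 h3 h4
  have hL : (1 : ℝ) ≤ L := by exact_mod_cast h2
  have hL0 : (0 : ℝ) < L := by linarith
  have hg := gammaSeq_pos hn h2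
  have hlg : 0 ≤ Real.log (Real.exp 1 / gammaSeq n L) := le_trans (by positivity) h3.1
  have hle : Real.log (Real.exp 1 * L) = 1 + Real.log L := by
    rw [Real.log_mul (Real.exp_ne_zero _) hL0.ne', Real.log_exp]
  have hl0 : 0 < Real.log (L : ℝ) := by linarith
  rw [Real.norm_of_nonneg (by positivity), Real.norm_of_nonneg (by positivity)]
  have hgle : gammaSeq n L ≤ (ν * 2) ^ (1 / ν) * (Real.log L ^ (1 / ν) / (L : ℝ) ^ (1 / ν)) := by
    rw [h1, ← Real.div_rpow hl0.le hL0.le, ← Real.mul_rpow (by positivity) (by positivity), hle]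
    refine Real.rpow_le_rpow (by positivity) ?_ (by positivity)
    rw [← mul_div_assoc]
    gcongr ?_ / _
    nlinarith
  calc (gammaSeq n L * Real.log (Real.exp 1 / gammaSeq n L)) ^ (D / 2)
      ≤ ((ν * 2) ^ (1 / ν) * (Real.log L ^ (1 / ν) / (L : ℝ) ^ (1 / ν)) *
          (2 * Real.log L)) ^ (D / 2) := by
        refine Real.rpow_le_rpow (by positivity) ?_ (by positivity)
        exact mul_le_mul hgle h3.2 hlg (by positivity)
    _ = ((ν * 2) ^ (1 / ν) * 2 * (Real.log L ^ (1 / ν + 1) / (L : ℝ) ^ (1 / ν))) ^ (D / 2) := by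
        rw [Real.rpow_add hl0, Real.rpow_one]
        congr 1
        ring
    _ = ((ν * 2) ^ (1 / ν) * 2) ^ (D / 2) *
          (Real.log L ^ ((1 / ν + 1) * (D / 2)) / (L : ℝ) ^ (1 / ν * (D / 2))) := by
        rw [Real.mul_rpow (by positivity) (by positivity), Real.div_rpow (by positivity)
          (by positivity), ← Real.rpow_mul hl0.le, ← Real.rpow_mul hL0.le]
    _ ≤ _ := by
        have e : 1 / ν * (D / 2) = D / (2 * ν) := by field_simp
        rw [e]
        -- The power of `log L` is `D/2` from the logarithm plus `D/(2ν) ≤ 1/2` from `γ_L`, whence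
        -- the exponent `(D + 1)/2`.
        have h5 : D / ν ≤ 1 := (div_le_one hν).mpr hDn
        have h6 : (1 / ν + 1) * (D / 2) = D / ν / 2 + D / 2 := by ring
        gcongr
        linarith

lemma missBound_gammaSeq_isBigO {n k p : ℕ} (hn : p + 1 < n) {C σ : ℝ} (hC : 0 < C)
    (hσ : 0 < σ) :
    (fun L : ℕ => missBound n k p C σ (gammaSeq n L) L) =O[atTop]
      fun L : ℕ => Real.log (L : ℝ) ^ (((n : ℝ) - (p : ℝ)) / 2) /
        (L : ℝ) ^ (((n : ℝ) - (p : ℝ) - 1) / (2 * ((n : ℝ) - 1))) := by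
  have hn2 : 2 ≤ n := by omega
  have hn' : (p : ℝ) + 2 ≤ n := by exact_mod_cast hn
  have hp : (0 : ℝ) ≤ p := p.cast_nonneg
  have hinv := inv_isBigO_log_rpow_div_rpow (a := ((n : ℝ) - p - 1) / (2 * ((n : ℝ) - 1)))
    (b := ((n : ℝ) - p) / 2) ((div_le_one (by linarith)).mpr (by linarith)) (by linarith)
  have hE2 := (exp_neg_mul_Psi_isBigO hn2 hC hσ fun L _ => le_rfl).trans hinv
  have hE1 := (exp_neg_mul_Psi_isBigO hn2 hC hσ
    (x := fun L => C * Real.log (Real.exp 1 / gammaSeq n L) / (2 * σ ^ 2 * gammaSeq n L))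
    fun L hL => by
      have hg := gammaSeq_pos hn2 (show 1 ≤ L by omega)
      have hg4 := gammaSeq_le n L
      set g := gammaSeq n L
      have h1 := one_le_log_exp_one_div hg (by linarith)
      have h2 : Real.log (Real.exp 1 / g) ≤ Real.exp 1 / g :=
        (Real.log_le_sub_one_of_pos (by positivity)).trans (by linarith)
      -- Cross-multiplied, this says that the argument of the first exponential dominates that of
      -- the second.
      have h3 : Real.log (Real.exp 1 / g) * g ≤ 8 := by
        rw [le_div_iff₀ hg] at h2
        linarith [Real.exp_one_lt_d9]
      rw [div_le_div_iff₀ (by positivity) (by positivity)]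
      have h4 : 0 ≤ 2 * C * σ ^ 2 * Real.log (Real.exp 1 / g) := by positivity
      nlinarith [mul_le_mul_of_nonneg_left h3 h4]).trans hinv
  have hcap := gammaSeq_mul_log_rpow_isBigO hn2 (D := (n : ℝ) - p - 1) (by linarith)
    (by linarith)
  rw [sub_add_cancel] at hcap
  have hmiss := (one_sub_pow_isBigO hn2).trans hinv
  exact (((hE1.add hE2).const_mul_left _).add (hcap.const_mul_left _)).add hmiss

end PartialShuffle

theorem mainTheorem8 {n k p₁ p₂ : ℕ}
    (X : Matrix (Fin n) (Fin p₁) ℝ) (Z : Matrix (Fin n) (Fin p₂) ℝ)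
    (τ₀ : Equiv.Perm (Fin n)) (hτ₀ : τ₀ ∈ PartialShuffle.sparsePerms n k)
    (β₁ : Fin p₁ → ℝ) (β₂ : Fin p₂ → ℝ) (σ₀ : ℝ) (hσ₀ : 0 < σ₀)
    (C : ℝ) (hC : C = PartialShuffle.cMinPartial k X Z τ₀ β₁ β₂) (hCpos : 0 < C)
    (hn : p₁ + p₂ + 1 < n) :
    (∀ L : ℕ, 2 ≤ L →
      ∀ (Ω : Type*) [MeasurableSpace Ω] (P : Measure Ω) [IsProbabilityMeasure P]
        (Ustar : Fin L → Ω → EuclideanSpace ℝ (Fin n)) (U : Ω → EuclideanSpace ℝ (Fin n)),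
        HasLaw (fun ω => ((fun l => Ustar l ω), U ω)) (PartialShuffle.noiseLaw n L) P →
        ∀ τhat : Fin L → Ω → Equiv.Perm (Fin n),
          (∀ l ω, τhat l ω ∈ PartialShuffle.reproArgmin k X Z
            (PartialShuffle.response X Z τ₀ β₁ β₂ σ₀ (U ω)) (Ustar l ω)) →
          (∀ γ : ℝ, 0 < γ → γ ≤ 1 / 4 →
            P.real {ω | τ₀ ∉ PartialShuffle.candidateSet k fun l => τhat l ω} ≤
              PartialShuffle.Delta n k (p₁ + p₂) C σ₀ γ +
                (1 - γ ^ (n - 1) / ((n : ℝ) - 1)) ^ L) ∧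
          P.real {ω | τ₀ ∉ PartialShuffle.candidateSet k fun l => τhat l ω} ≤
            PartialShuffle.missBound n k (p₁ + p₂) C σ₀ (PartialShuffle.gammaSeq n L) L) ∧
    (fun L : ℕ =>
        PartialShuffle.missBound n k (p₁ + p₂) C σ₀ (PartialShuffle.gammaSeq n L) L) =O[atTop]
      (fun L : ℕ => Real.log (L : ℝ) ^ (((n : ℝ) - ((p₁ : ℝ) + (p₂ : ℝ))) / 2) /
        (L : ℝ) ^ (((n : ℝ) - ((p₁ : ℝ) + (p₂ : ℝ)) - 1) / (2 * ((n : ℝ) - 1)))) := by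
  refine ⟨fun L hL Ω _ P _ Ustar U hlaw τhat hτhat => ?_, ?_⟩
  · have h : ∀ γ : ℝ, 0 < γ → γ ≤ 1 / 4 →
        P.real {ω | τ₀ ∉ PartialShuffle.candidateSet k fun l => τhat l ω} ≤
          PartialShuffle.Delta n k (p₁ + p₂) C σ₀ γ +
            (1 - γ ^ (n - 1) / ((n : ℝ) - 1)) ^ L := fun γ hγ hγ4 =>
      PartialShuffle.measureReal_notMem_candidateSet_le X Z hτ₀ hσ₀ hC hCpos hn hlaw hτhat hγ hγ4
    exact ⟨h, h _ (PartialShuffle.gammaSeq_pos (by omega) (by omega))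
      (PartialShuffle.gammaSeq_le n L)⟩
  · have h := PartialShuffle.missBound_gammaSeq_isBigO (k := k) hn hCpos hσ₀
    simpa only [Nat.cast_add] using h
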